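/- **Setting.** Let $a(n)\ge 0$ $(n\ge 1)$ be real numbers, and put $\mathcal A(y)=\sum_{n\le y}a(n)$ and $\mathcal A(y;q,b)=\sum_{n\le y,\ n\equiv b\,(q)}a(n)$. Let $\mathcal S$ be a finite set of primes, and let $h$ be a multiplicative function with $0\le h(n)\le 1$ for all $n\ge 1$. For $q\ge 1$ put $\gamma_q=\prod_{p\mid q}\Big(\frac{1-h(p)/p}{1-1/p}\Big)^{-1}$, and let $f_q$ be the multiplicative function with $f_q(b)=f_q((b,q))$ such that $f_q(p^k)=1$ if $p\nmid q$ and, if $p^e$ with $e\ge1$ is the exact power of the prime $p$ dividing $q$, $$f_q(p^k)=\begin{cases}\big(h(p^k)-h(p^{k+1})/p\big)\big(1-h(p)/p\big)^{-1}, & k<e,\\ h(p^e)\,(1-1/p)\big(1-h(p)/p\big)^{-1}, & k\ge e.\end{cases}$$ For real $x>0$ with $\mathcal A(x)>0$ and for $y>0$ define $$\Delta_q=\Delta_q(x)=\sup_{x/4\le t\le x}\ \max_{b\,(\mathrm{mod}\ q)}\Big|\mathcal A(t;q,b)-\frac{f_q(b)}{q\gamma_q}\,\frac tx\,\mathcal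 A(x)\Big|\Big/\frac{\mathcal A(x)}{\phi(q)},$$ $$\tilde\Delta(y)=\tilde\Delta(y,x)=\sup_{(v,v+y)\subset(x/4,x)}\Big|\mathcal A(v+y)-\mathcal A(v)-y\,\frac{\mathcal A(x)}{x}\Big|\Big/\Big(y\,\frac{\mathcal A(x)}{x}\Big),$$ where the second supremum is taken to be $0$ if there is no such interval. **Theorem 2.5.** There are absolute constants $c>0$ and $x_0$ such that the following holds for every real $x\ge x_0$ and all $a$, $\mathcal S$, $h$ as above with $\mathcal A(x)>0$ and $\mathcal S\subset[1,\log\log x]$. Let $\frac1{100}\ge\eta\ge 20\,\frac{\log\log\log x}{\log\log x}$ and suppose that $(\log x)^{\eta}\le z\le \frac13\log x$ is such that $$\sum_{z^{1-\eta}\le p\le z}\frac{1-h(p)}{p}\ \ge\ \eta\log\big((1-\eta)^{-1}\big).$$ Then for each $5/\eta^2\le u\le\sqrt z$ at least one of the following statements is true: (i) Every positive integer $q\le e^{2z}$ that is composed only of primes in $[z^{1-\eta},z]$ and satisfies $\sum_{p\mid q}(1-h(p))/p\ge\eta^2$ is coprime to every prime in $\mathcal S$ and has $$\Delta_q\ \ge\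 c\,\exp\Big(-u(1+25\eta)\log\frac{2u}{\eta^2}\Big).$$ (ii) There exists a real $y\ge z^u$ with $$\tilde\Delta(y)\ \ge\ c\,\exp\Big(-u(1+25\eta)\log\frac{2u}{\eta^2}\Big).$$ -/

import Mathlib

/-! Distribution of a sequence `a(n)` of non-negative reals, `n ≥ 1`, in arithmetic progressions
and in short intervals, relative to a multiplicative density function `h`. -/

noncomputable section

namespace SeqDistribution

/-- The counting function `𝒜(y) = ∑_{1 ≤ n ≤ y} a(n)`. -/
def count (a : ℕ → ℝ) (y : ℝ) : ℝ :=
  ∑ n ∈ Finset.Icc 1 ⌊y⌋₊, a n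

/-- `𝒜(y; q, b) = ∑_{1 ≤ n ≤ y, n ≡ b (mod q)} a(n)`. -/
def countAP (a : ℕ → ℝ) (y : ℝ) (q b : ℕ) : ℝ :=
  ∑ n ∈ (Finset.Icc 1 ⌊y⌋₊).filter (fun n => n ≡ b [MOD q]), a n

/-- `γ_q = ∏_{p ∣ q} ((1 - h(p)/p) / (1 - 1/p))⁻¹`. -/
def gammaFactor (h : ArithmeticFunction ℝ) (q : ℕ) : ℝ :=
  ∏ p ∈ q.primeFactors, ((1 - h p / (p : ℝ)) / (1 - 1 / (p : ℝ)))⁻¹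

/-- The value `f_q(p^k)` at a power of a prime `p` dividing `q`, where `p^e` is the exact power of
`p` dividing `q`. -/
def localFactor (h : ArithmeticFunction ℝ) (q p k : ℕ) : ℝ :=
  if k < q.factorization p then
    (h (p ^ k) - h (p ^ (k + 1)) / (p : ℝ)) * (1 - h p / (p : ℝ))⁻¹
  else
    h (p ^ q.factorization p) * (1 - 1 / (p : ℝ)) * (1 - h p / (p : ℝ))⁻¹

/-- The `q`-periodic multiplicative function `f_q`, with `f_q(b) = f_q((b, q))`, `f_q(p^k) = 1` for
`p ∤ q`, and `f_q(p^k) = localFactor h q p k` for `p ∣ q`. -/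
def fFun (h : ArithmeticFunction ℝ) (q b : ℕ) : ℝ :=
  ∏ p ∈ q.primeFactors, localFactor h q p ((Nat.gcd b q).factorization p)

/-- The discrepancy `Δ_q(x)` in arithmetic progressions modulo `q`: the supremum over real
`y ∈ [x/4, x]` and over residue classes `b (mod q)` of
`|𝒜(y; q, b) - f_q(b)/(q γ_q) · (y/x) · 𝒜(x)| / (𝒜(x)/φ(q))`.
The set of these values is bounded. -/
def apDiscrepancy (a : ℕ → ℝ) (h : ArithmeticFunction ℝ) (x : ℝ) (q : ℕ) : ℝ :=
  sSup {t : ℝ | ∃ y ∈ Set.Icc (x / 4) x, ∃ b : ℕ,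
    t = |countAP a y q b - fFun h q b / ((q : ℝ) * gammaFactor h q) * (y / x) * count a x| /
      (count a x / (Nat.totient q : ℝ))}

/-- The discrepancy in short intervals of length `y`: the supremum over the intervals
`(v, v + y) ⊆ (x/4, x)` of `|𝒜(v + y) - 𝒜(v) - y 𝒜(x)/x| / (y 𝒜(x)/x)`.
The set of these values is bounded when `y > 0`; if no such interval exists the value is `0`. -/
def intervalDiscrepancy (a : ℕ → ℝ) (x y : ℝ) : ℝ :=
  sSup {t : ℝ | ∃ v : ℝ, Set.Ioo v (v + y) ⊆ Set.Ioo (x / 4) x ∧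
    t = |count a (v + y) - count a v - y * (count a x / x)| / (y * (count a x / x))}

end SeqDistribution

end

/-! Maier's matrix method. Arrange the integers `(R+r)q+s` with `s ≤ y` in an array: its rows are
intervals of length `y`, its columns are progressions modulo `q`. Summing `a` over the array both
ways bounds `∑_{s≤y} f_q(s) - γ_q y` by `y` times a combination of the two discrepancies
(`maier_matrix`). It is therefore enough that, for each admissible `q`, this error is large at some
`y ≥ z^u` (`exists_large_error`); if (ii) fails, the progressions modulo every such `q` must be
responsible.

Write `f_q` as a divisor sum with weights `g = μ * f_q` on the divisors of `q`. The error is then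
exactly `-F(y)` with `F(y) = ∑ g(d){y/d}` (`sum_fFun_sub`), and the Mellin transform of `F` is `∑
g(d) d^(-s)` times that of `{t}`. Take `s = 1 - ξ/log z - iπ/log z`. The primes of `q` lie so close
to `z` on the logarithmic scale that `p^(-s)` is nearly negative, and `g(p)` is nearly `-(1-h(p))`;
hence the Euler factors reinforce each other and the Dirichlet polynomial has size about `e^H`, with
`H = ∑ (1-h(p)) p^(-Re s)` (`norm_sum_expCoeff_ge`).

The same transform is at most the integral of `|F(t)| t^(-Re s - 1)`. Below `z^u` and above
`z^((1+θ)u)`, Rankin's trick with the real part moved by `±δ/log z` gives less than the main term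
once `ξ` is the saddle point `H = (1+θ/2)u` (`exists_primeSum_eq`, `Params.near_le`,
`Params.far_le`). So `|F(y)|/y` is large somewhere in between. The saddle satisfies `ξ(1-η) <
log(2u/η²)`, and this fixes the size of the lower bound (`Params.mid_le`). -/

noncomputable section

/-! ### Expansion of `f_q` over the divisors of `q`. -/

namespace SeqDistribution

open Finset

/-- The Möbius-type differences `(μ * f_q)(p^j)` of the local factors of `f_q`. -/
def localDiff (h : ArithmeticFunction ℝ) (q p : ℕ) : ℕ → ℝ
  | 0 => 1
  | j + 1 => localFactor h q p (j + 1) - localFactor h q p j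

/-- Exponent vectors of the divisors of `q`. -/
def exponents (q : ℕ) : Finset (q.primeFactors → ℕ) :=
  Fintype.piFinset fun i => range (q.factorization i + 1)

/-- The divisor of `q` with a given exponent vector. -/
def expVal (q : ℕ) (k : q.primeFactors → ℕ) : ℕ := ∏ i : q.primeFactors, (i : ℕ) ^ k i

/-- The value of `μ * f_q` at the divisor of `q` with a given exponent vector. -/
def expCoeff (h : ArithmeticFunction ℝ) (q : ℕ) (k : q.primeFactors → ℕ) : ℝ :=
  ∏ i : q.primeFactors, localDiff h q i (k i)

lemma expVal_pos (q : ℕ) (k : q.primeFactors → ℕ) : 0 < expVal q k :=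
  prod_pos fun i _ => pow_pos (Nat.prime_of_mem_primeFactors i.2).pos _

/-- The Euler product, for any completely multiplicative `φ`. It serves three times: with `n⁻¹` for
the mean value, with `n^(-σ)` and absolute values for upper bounds, and with `n^(-s)` for the lower
bound. -/
lemma sum_exponents {R : Type*} [CommSemiring R] (q : ℕ) (W : ℕ → ℕ → R) (φ : ℕ →* R) :
    ∑ k ∈ exponents q, (∏ i : q.primeFactors, W i (k i)) * φ (expVal q k) =
      ∏ p ∈ q.primeFactors, ∑ j ∈ range (q.factorization p + 1), W p j * φ p ^ j := by
  rw [← Finset.prod_coe_sort, Finset.prod_univ_sum]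
  refine sum_congr rfl fun k _ => ?_
  simp only [expVal, map_prod, map_pow, prod_mul_distrib]

lemma one_sub_div_pos {t : ℝ} {p : ℕ} (hp : p.Prime) (ht : t ≤ 1) : 0 < 1 - t / (p : ℝ) := by
  have h2 : (2 : ℝ) ≤ p := by exact_mod_cast hp.two_le
  have : t / (p : ℝ) ≤ 1 / p := by gcongr
  have : (1 : ℝ) / p ≤ 1 / 2 := by gcongr
  linarith

lemma localFactor_zero {h : ArithmeticFunction ℝ} (hm : h.IsMultiplicative)
    (h1 : ∀ n, 0 ≤ h n ∧ h n ≤ 1) {q p : ℕ} (hq : 0 < q.factorization p) (hp : p.Prime) :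
    localFactor h q p 0 = 1 := by
  have := one_sub_div_pos hp (h1 p).2
  simp only [localFactor, hq, if_true, pow_zero, zero_add, pow_one, hm.map_one]
  field_simp

lemma sum_localDiff {h : ArithmeticFunction ℝ} (hm : h.IsMultiplicative)
    (h1 : ∀ n, 0 ≤ h n ∧ h n ≤ 1) {q p : ℕ} (hq : 0 < q.factorization p) (hp : p.Prime) (m : ℕ) :
    ∑ j ∈ range (m + 1), localDiff h q p j = localFactor h q p m := by
  induction m with
  | zero => simp [localDiff, localFactor_zero hm h1 hq hp]
  | succ m ih => rw [sum_range_succ, ih]; simp [localDiff]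

lemma expVal_dvd_iff {q : ℕ} {k : q.primeFactors → ℕ} {b : ℕ} :
    expVal q k ∣ b ↔ ∀ i : q.primeFactors, (i : ℕ) ^ k i ∣ b := by
  constructor
  · intro hd i
    exact (dvd_prod_of_mem (fun i : q.primeFactors => (i : ℕ) ^ k i) (mem_univ i)).trans hd
  · intro hd
    refine Finset.prod_dvd_of_isRelPrime ?_ fun i _ => hd i
    intro i _ j _ hij
    refine (Nat.coprime_iff_isRelPrime.1 (Nat.Coprime.pow _ _ ?_))
    exact (Nat.coprime_primes (Nat.prime_of_mem_primeFactors i.2)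
      (Nat.prime_of_mem_primeFactors j.2)).2 fun hh => hij (Subtype.ext hh)

lemma factorization_pos_of_mem {q p : ℕ} (hp : p ∈ q.primeFactors) : 0 < q.factorization p :=
  (Nat.prime_of_mem_primeFactors hp).factorization_pos_of_dvd
    (Nat.mem_primeFactors.1 hp).2.2 (Nat.dvd_of_mem_primeFactors hp)

/-- At each prime the differences telescope up to the exponent of `p` in `(b, q)`, and for `j` up to
the exponent in `q` these are exactly the `j` with `p^j ∣ b`. Multiplying out over the primes gives
the divisor sum. -/
lemma fFun_eq_sum {h : ArithmeticFunction ℝ} (hm : h.IsMultiplicative)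
    (h1 : ∀ n, 0 ≤ h n ∧ h n ≤ 1) {q : ℕ} (hq : q ≠ 0) (b : ℕ) :
    fFun h q b = ∑ k ∈ exponents q, expCoeff h q k * if expVal q k ∣ b then 1 else 0 := by
  have hloc : ∀ p ∈ q.primeFactors, localFactor h q p ((Nat.gcd b q).factorization p) =
      ∑ j ∈ range (q.factorization p + 1),
        localDiff h q p j * if p ^ j ∣ b then 1 else 0 := by
    intro p hp
    have hpp := Nat.prime_of_mem_primeFactors hp
    have hg : Nat.gcd b q ≠ 0 := Nat.gcd_ne_zero_right hq
    rw [← sum_localDiff hm h1 (factorization_pos_of_mem hp) hpp]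
    have hle : (Nat.gcd b q).factorization p ≤ q.factorization p :=
      (Nat.factorization_le_iff_dvd hg hq).2 (Nat.gcd_dvd_right _ _) p
    have hsub : range ((Nat.gcd b q).factorization p + 1) ⊆ range (q.factorization p + 1) := by
      apply range_subset_range.2; omega
    rw [← sum_subset hsub]
    · refine sum_congr rfl fun j hj => ?_
      have : p ^ j ∣ b := ((hpp.pow_dvd_iff_le_factorization hg).2
        (by simpa [Nat.lt_succ_iff] using hj)).trans (Nat.gcd_dvd_left _ _)
      simp [this]
    · intro j hj hj'
      have : ¬ p ^ j ∣ b := by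
        intro hd
        apply hj'
        rw [mem_range, Nat.lt_succ_iff, ← hpp.pow_dvd_iff_le_factorization hg]
        refine Nat.dvd_gcd hd ((hpp.pow_dvd_iff_le_factorization hq).2 ?_)
        simpa [Nat.lt_succ_iff] using hj
      simp [this]
  rw [fFun, prod_congr rfl hloc, ← Finset.prod_coe_sort, Finset.prod_univ_sum]
  refine sum_congr rfl fun k _ => ?_
  rw [prod_mul_distrib, expCoeff]
  congr 1
  by_cases hd : expVal q k ∣ b
  · rw [if_pos hd]
    exact prod_eq_one fun i _ => if_pos (expVal_dvd_iff.1 hd i)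
  · rw [if_neg hd]
    rw [expVal_dvd_iff] at hd
    push Not at hd
    obtain ⟨i, hi⟩ := hd
    exact prod_eq_zero (mem_univ i) (if_neg hi)

lemma sum_localDiff_inv_pow {h : ArithmeticFunction ℝ} (hm : h.IsMultiplicative)
    (h1 : ∀ n, 0 ≤ h n ∧ h n ≤ 1) {q p : ℕ} (hq : 0 < q.factorization p) (hp : p.Prime) :
    ∑ j ∈ range (q.factorization p + 1), localDiff h q p j * ((p : ℝ)⁻¹) ^ j =
      ((1 - h p / (p : ℝ)) / (1 - 1 / (p : ℝ)))⁻¹ := by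
  have ha := one_sub_div_pos hp (h1 p).2
  have hb := one_sub_div_pos hp le_rfl
  set x : ℝ := (p : ℝ)⁻¹ with hx
  have hp0 : (p : ℝ) ≠ 0 := by exact_mod_cast hp.ne_zero
  rw [div_eq_mul_inv] at ha hb
  -- Abel summation: in `(1-x) ∑ f(p^j) x^j + f(p^m) x^(m+1)` the inner sum telescopes. The last
  -- exponent is added separately because the formula for `f` changes there.
  have key : ∀ m, m < q.factorization p →
      ∑ j ∈ range (m + 1), localDiff h q p j * x ^ j =
        ((1 - x) * (1 - h (p ^ (m + 1)) * x ^ (m + 1)) +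
          x ^ (m + 1) * (h (p ^ m) - h (p ^ (m + 1)) * x)) * (1 - h p * x)⁻¹ := by
    intro m
    induction m with
    | zero =>
      intro _
      simp only [localDiff, zero_add, sum_range_one, pow_zero, pow_one, hm.map_one]
      rw [eq_mul_inv_iff_mul_eq₀ ha.ne']
      ring
    | succ m ih =>
      intro hlt
      rw [sum_range_succ, ih (by omega)]
      simp only [localDiff, localFactor, if_pos hlt, if_pos (show m < q.factorization p by omega),
        div_eq_mul_inv, ← hx]
      ring
  obtain ⟨m, hm'⟩ : ∃ m, q.factorization p = m + 1 := ⟨_, (Nat.succ_pred_eq_of_pos hq).symm⟩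
  rw [hm', sum_range_succ, key m (by omega)]
  simp only [localDiff, localFactor, hm', lt_irrefl, if_false,
    if_pos (show m < m + 1 by omega), div_eq_mul_inv, ← hx, mul_inv, inv_inv]
  rw [← sub_eq_zero]
  field_simp
  ring

/-- Identifies `γ_q` as the mean value of `f_q`, so that the linear terms cancel exactly in
`sum_fFun_sub` and only fractional parts remain. -/
lemma gammaFactor_eq_sum {h : ArithmeticFunction ℝ} (hm : h.IsMultiplicative)
    (h1 : ∀ n, 0 ≤ h n ∧ h n ≤ 1) (q : ℕ) :
    gammaFactor h q = ∑ k ∈ exponents q, expCoeff h q k / (expVal q k : ℝ) := by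
  let φ : ℕ →* ℝ := ((invMonoidWithZeroHom : ℝ →*₀ ℝ) : ℝ →* ℝ).comp (Nat.castRingHom ℝ : ℕ →* ℝ)
  have hφ : ∀ n : ℕ, φ n = (n : ℝ)⁻¹ := fun n => rfl
  have := sum_exponents q (localDiff h q) φ
  simp only [hφ] at this
  simp only [expCoeff, div_eq_mul_inv]
  rw [this]
  refine prod_congr rfl fun p hp => ?_
  rw [sum_localDiff_inv_pow hm h1 (factorization_pos_of_mem hp) (Nat.prime_of_mem_primeFactors hp)]

/-- The error term in the summation of `f_q` is a combination of fractional parts. -/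
lemma sum_fFun_sub {h : ArithmeticFunction ℝ} (hm : h.IsMultiplicative)
    (h1 : ∀ n, 0 ≤ h n ∧ h n ≤ 1) {q : ℕ} (hq : q ≠ 0) {y : ℝ} (hy : 0 ≤ y) :
    ∑ s ∈ Icc 1 ⌊y⌋₊, fFun h q s - gammaFactor h q * y =
      -∑ k ∈ exponents q, expCoeff h q k * Int.fract ((expVal q k : ℝ)⁻¹ * y) := by
  rw [sum_congr rfl fun s _ => fFun_eq_sum hm h1 hq s, sum_comm, gammaFactor_eq_sum hm h1,
    sum_mul, ← sum_sub_distrib, ← sum_neg_distrib]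
  refine sum_congr rfl fun k _ => ?_
  rw [← mul_sum, sum_boole]
  have hcard : (#{s ∈ Icc 1 ⌊y⌋₊ | expVal q k ∣ s}) = ⌊y⌋₊ / expVal q k := by
    rw [← Nat.Ioc_filter_dvd_card_eq_div]
    rfl
  rw [hcard, ← Nat.floor_div_natCast, Int.fract, natCast_floor_eq_intCast_floor (by positivity),
    inv_mul_eq_div]
  ring

lemma gammaFactor_pos {h : ArithmeticFunction ℝ} (h1 : ∀ n, 0 ≤ h n ∧ h n ≤ 1) (q : ℕ) :
    0 < gammaFactor h q :=
  prod_pos fun p hp => inv_pos.2 (div_pos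
    (one_sub_div_pos (Nat.prime_of_mem_primeFactors hp) (h1 p).2)
    (one_sub_div_pos (Nat.prime_of_mem_primeFactors hp) le_rfl))

lemma gammaFactor_le_one {h : ArithmeticFunction ℝ} (h1 : ∀ n, 0 ≤ h n ∧ h n ≤ 1) (q : ℕ) :
    gammaFactor h q ≤ 1 := by
  refine prod_le_one (fun p hp => ?_) fun p hp => ?_
  · exact (inv_pos.2 (div_pos
      (one_sub_div_pos (Nat.prime_of_mem_primeFactors hp) (h1 p).2)
      (one_sub_div_pos (Nat.prime_of_mem_primeFactors hp) le_rfl))).le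
  · apply inv_le_one_of_one_le₀
    rw [one_le_div (one_sub_div_pos (Nat.prime_of_mem_primeFactors hp) le_rfl)]
    have := (h1 p).2
    gcongr

end SeqDistribution

/-! ### Mellin transforms of fractional parts. -/

namespace SeqDistribution

open Finset MeasureTheory Set Filter Asymptotics

/-- The Mellin transform of the fractional part, `∫ t^(-s-1) {t} dt`. -/
def fractMellin (s : ℂ) : ℂ := mellin (fun t : ℝ => ((Int.fract t : ℝ) : ℂ)) (-s)

lemma mellinConvergent_fract {s : ℂ} (h0 : 0 < s.re) (h1 : s.re < 1) :
    MellinConvergent (fun t : ℝ => ((Int.fract t : ℝ) : ℂ)) (-s) := by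
  have hmeas : Measurable (fun t : ℝ => ((Int.fract t : ℝ) : ℂ)) := by fun_prop
  refine mellinConvergent_of_isBigO_rpow (a := 0) (b := -1) ?_ ?_ (by simpa) ?_ (by simpa)
  · have : LocallyIntegrable (fun t : ℝ => ((Int.fract t : ℝ) : ℂ)) := by
      refine (locallyIntegrable_const (1 : ℝ)).mono hmeas.aestronglyMeasurable ?_
      filter_upwards with t
      rw [Complex.norm_real, Real.norm_of_nonneg (Int.fract_nonneg t)]
      simpa using (Int.fract_lt_one t).le
    exact this.locallyIntegrableOn _
  · refine IsBigO.of_bound 1 ?_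
    filter_upwards with t
    rw [Complex.norm_real, Real.norm_of_nonneg (Int.fract_nonneg t)]
    simpa using (Int.fract_lt_one t).le
  · refine IsBigO.of_bound 1 ?_
    filter_upwards [self_mem_nhdsWithin] with t ht
    rw [Complex.norm_real, Real.norm_of_nonneg (Int.fract_nonneg t)]
    simp only [neg_neg, Real.rpow_one, one_mul]
    rw [Real.norm_of_nonneg (le_of_lt ht)]
    have : (0 : ℤ) ≤ ⌊t⌋ := Int.floor_nonneg.2 (le_of_lt ht)
    have : (0 : ℝ) ≤ ⌊t⌋ := by exact_mod_cast this
    rw [Int.fract]; linarith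

lemma integral_Ioc_fract {s : ℂ} (h1 : s.re < 1) :
    ∫ t in Ioc (0 : ℝ) 1, (t : ℂ) ^ (-s - 1) • ((Int.fract t : ℝ) : ℂ) = 1 / (1 - s) := by
  have hs : (1 : ℂ) - s ≠ 0 := fun hh => by
    have := congrArg Complex.re hh
    simp at this; linarith
  rw [integral_Ioc_eq_integral_Ioo]
  have : ∀ t ∈ Ioo (0 : ℝ) 1,
      (t : ℂ) ^ (-s - 1) • ((Int.fract t : ℝ) : ℂ) = (t : ℂ) ^ (-s) := by
    intro t ht
    rw [Int.fract_eq_self.2 ⟨ht.1.le, ht.2⟩, Complex.cpow_sub _ _ (by exact_mod_cast ht.1.ne'),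
      Complex.cpow_one, smul_eq_mul, div_mul_cancel₀ _ (by exact_mod_cast ht.1.ne')]
  rw [setIntegral_congr_fun measurableSet_Ioo this, ← integral_Ioc_eq_integral_Ioo,
    ← intervalIntegral.integral_of_le zero_le_one, integral_cpow (Or.inl (by simpa using h1))]
  have hs' : -s + 1 ≠ 0 := by rwa [neg_add_eq_sub]
  rw [Complex.ofReal_zero, Complex.zero_cpow hs', Complex.ofReal_one, Complex.one_cpow, sub_zero,
    neg_add_eq_sub]

/-- The cosine is nonnegative until `t = e^(π/(2τ))`, and from there on `t^(σ/2)` outweighs the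
exponential factor. -/
lemma cos_ge_neg_rpow {σ τ t : ℝ} (hσ : 0 < σ) (hτ : 0 < τ) (ht : 1 ≤ t) :
    -(Real.exp (-(Real.pi * σ / (4 * τ))) * t ^ (σ / 2)) ≤ Real.cos (τ * Real.log t) := by
  have ht0 : 0 < t := by linarith
  have hlog := Real.log_nonneg ht
  rcases le_or_gt (τ * Real.log t) (Real.pi / 2) with hle | hgt
  · have := Real.cos_nonneg_of_neg_pi_div_two_le_of_le
      (by have := Real.pi_pos; nlinarith [mul_nonneg hτ.le hlog]) hle
    have : 0 ≤ Real.exp (-(Real.pi * σ / (4 * τ))) * t ^ (σ / 2) := by positivity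
    linarith
  · refine le_trans ?_ (Real.neg_one_le_cos _)
    rw [neg_le_neg_iff, Real.rpow_def_of_pos ht0, ← Real.exp_add]
    apply Real.one_le_exp
    have : Real.pi * σ / (4 * τ) = (Real.pi / 2) * (σ / 2 / τ) := by field_simp; ring
    rw [this]
    have : Real.log t * (σ / 2) = (τ * Real.log t) * (σ / 2 / τ) := by field_simp
    rw [this]
    have : 0 < σ / 2 / τ := by positivity
    nlinarith

/-- Bound the real part. The range `t ≤ 1` contributes exactly `1/(1-s)`; on `t > 1` the kernel
`t^(-σ-1) cos(τ log t)` becomes negative only beyond `e^(π/(2τ))`, which costs little when `τ` is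
small. -/
lemma norm_fractMellin_ge {σ τ : ℝ} (h0 : 0 < σ) (h1 : σ < 1) (hτ : 0 < τ) :
    (1 - σ) / ((1 - σ) ^ 2 + τ ^ 2) - Real.exp (-(Real.pi * σ / (4 * τ))) * (2 / σ) ≤
      ‖fractMellin ⟨σ, -τ⟩‖ := by
  set s : ℂ := ⟨σ, -τ⟩ with hs
  have hre : s.re = σ := rfl
  have him : s.im = -τ := rfl
  have hconv := mellinConvergent_fract (s := s) h0 h1
  rw [MellinConvergent] at hconv
  have hsplit : fractMellin s = 1 / (1 - s) +
      ∫ t in Ioi (1 : ℝ), (t : ℂ) ^ (-s - 1) • ((Int.fract t : ℝ) : ℂ) := by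
    rw [fractMellin, mellin, ← Ioc_union_Ioi_eq_Ioi (zero_le_one (α := ℝ)),
      setIntegral_union (Ioc_disjoint_Ioi le_rfl) measurableSet_Ioi
        (hconv.mono_set Ioc_subset_Ioi_self) (hconv.mono_set (Ioi_subset_Ioi zero_le_one)),
      integral_Ioc_fract h1]
  have hint := hconv.mono_set (Ioi_subset_Ioi (zero_le_one (α := ℝ)))
  have hfirst : (1 / (1 - s)).re = (1 - σ) / ((1 - σ) ^ 2 + τ ^ 2) := by
    rw [one_div, Complex.inv_re, Complex.normSq_apply]
    simp only [Complex.sub_re, Complex.sub_im, Complex.one_re, Complex.one_im, hre, him]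
    congr 1
    ring
  have hsecond : -(Real.exp (-(Real.pi * σ / (4 * τ))) * (2 / σ)) ≤
      (∫ t in Ioi (1 : ℝ), (t : ℂ) ^ (-s - 1) • ((Int.fract t : ℝ) : ℂ)).re := by
    have hr : (∫ t in Ioi (1 : ℝ), (t : ℂ) ^ (-s - 1) • ((Int.fract t : ℝ) : ℂ)).re =
        ∫ t in Ioi (1 : ℝ), ((t : ℂ) ^ (-s - 1) • ((Int.fract t : ℝ) : ℂ)).re :=
      (integral_re hint).symm
    rw [hr]
    have hval : ∫ t in Ioi (1 : ℝ), -(Real.exp (-(Real.pi * σ / (4 * τ)))) * t ^ (-σ / 2 - 1) =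
        -(Real.exp (-(Real.pi * σ / (4 * τ))) * (2 / σ)) := by
      rw [integral_const_mul, integral_Ioi_rpow_of_lt (by linarith) one_pos]
      rw [Real.one_rpow, show -σ / 2 - 1 + 1 = -(σ / 2) by ring, div_neg, neg_div, neg_neg,
        one_div_div, neg_mul]
    rw [← hval]
    refine setIntegral_mono_on ((integrableOn_Ioi_rpow_of_lt (by linarith) one_pos).const_mul _)
      hint.re measurableSet_Ioi fun t ht => ?_
    have ht1 : (1 : ℝ) < t := ht
    have ht0 : 0 < t := by linarith
    have hcre : ((t : ℂ) ^ (-s - 1)).re = t ^ (-σ - 1) * Real.cos (τ * Real.log t) := by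
      rw [Complex.cpow_def_of_ne_zero (by exact_mod_cast ht0.ne'), ← Complex.ofReal_log ht0.le,
        Complex.exp_re, Real.rpow_def_of_pos ht0]
      simp [hre, him, mul_comm]
    have hcos := cos_ge_neg_rpow h0 hτ ht1.le
    rw [smul_eq_mul, Complex.re_mul_ofReal, hcre]
    have hp : t ^ (-σ / 2 - 1) = t ^ (-σ - 1) * t ^ (σ / 2) := by
      rw [← Real.rpow_add ht0]; congr 1; ring
    rw [hp]
    have hf0 := Int.fract_nonneg t
    have hf1 := (Int.fract_lt_one t).le
    have hA : 0 ≤ Real.exp (-(Real.pi * σ / (4 * τ))) * t ^ (σ / 2) := by positivity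
    have hB : 0 ≤ t ^ (-σ - 1) := by positivity
    have : -(Real.exp (-(Real.pi * σ / (4 * τ))) * t ^ (σ / 2)) ≤
        Real.cos (τ * Real.log t) * Int.fract t := by
      nlinarith [mul_nonneg (sub_nonneg.2 hcos) hf0, mul_nonneg hA (sub_nonneg.2 hf1)]
    nlinarith [mul_le_mul_of_nonneg_left this hB]
  calc _ ≤ (fractMellin s).re := by rw [hsplit, Complex.add_re, hfirst]; linarith
    _ ≤ _ := Complex.re_le_norm _

section FractCombination

variable {ι : Type*} (K : Finset ι) (c d : ι → ℝ)

/-- A linear combination of dilated fractional parts. -/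
def fractComb (y : ℝ) : ℝ := ∑ k ∈ K, c k * Int.fract ((d k)⁻¹ * y)

variable {K c d}

lemma hasMellin_fractComb (hd : ∀ k ∈ K, 0 < d k) {s : ℂ} (h0 : 0 < s.re) (h1 : s.re < 1) :
    MellinConvergent (fun t : ℝ => (fractComb K c d t : ℂ)) (-s) ∧
    mellin (fun t : ℝ => (fractComb K c d t : ℂ)) (-s) =
      (∑ k ∈ K, (c k : ℂ) * (d k : ℂ) ^ (-s)) * fractMellin s := by
  have hterm : ∀ k ∈ K, HasMellin
      (fun t : ℝ => (c k : ℂ) • ((Int.fract ((d k)⁻¹ * t) : ℝ) : ℂ)) (-s)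
      ((c k : ℂ) * (d k : ℂ) ^ (-s) * fractMellin s) := by
    intro k hk
    have hdk := inv_pos.2 (hd k hk)
    have hc := (MellinConvergent.comp_mul_left (s := -s)
      (f := fun t : ℝ => ((Int.fract t : ℝ) : ℂ)) hdk).2 (mellinConvergent_fract h0 h1)
    have hval := mellin_comp_mul_left (fun t : ℝ => ((Int.fract t : ℝ) : ℂ)) (-s) hdk
    refine ⟨hc.const_smul _, ?_⟩
    rw [mellin_const_smul, hval, fractMellin, smul_eq_mul, smul_eq_mul, mul_assoc]
    congr 2
    rw [neg_neg, Complex.ofReal_inv, Complex.inv_cpow _ _ (by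
      rw [Complex.arg_ofReal_of_nonneg (hd k hk).le]; exact Real.pi_pos.ne), Complex.cpow_neg]
  have hfun : ∀ t : ℝ, (t : ℂ) ^ (-s - 1) • (fractComb K c d t : ℂ) =
      ∑ k ∈ K, (t : ℂ) ^ (-s - 1) • ((c k : ℂ) • ((Int.fract ((d k)⁻¹ * t) : ℝ) : ℂ)) := by
    intro t
    simp only [fractComb, smul_eq_mul, Complex.ofReal_sum, Complex.ofReal_mul, mul_sum]
  constructor
  · rw [MellinConvergent]
    simp only [hfun]
    exact integrable_finsetSum _ fun k hk => (hterm k hk).1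
  · rw [mellin]
    simp only [hfun]
    rw [integral_finsetSum _ fun k hk => (hterm k hk).1, sum_mul]
    exact sum_congr rfl fun k hk => (hterm k hk).2

lemma fract_le_rpow {σ t : ℝ} (h0 : 0 ≤ σ) (h1 : σ ≤ 1) (ht : 0 < t) : Int.fract t ≤ t ^ σ := by
  rcases le_or_gt 1 t with h | h
  · exact (Int.fract_lt_one t).le.trans (Real.one_le_rpow h h0)
  · rw [Int.fract_eq_self.2 ⟨ht.le, h⟩]
    simpa using Real.rpow_le_rpow_of_exponent_ge ht h.le h1

/-- Rankin's trick: `{t} ≤ t^σ` for every `σ` in `[0, 1]`, so the exponent may be chosen to suit the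
range of `y`. -/
lemma abs_fractComb_le (hd : ∀ k ∈ K, 0 < d k) {σ : ℝ} (h0 : 0 ≤ σ) (h1 : σ ≤ 1) {y : ℝ}
    (hy : 0 < y) :
    |fractComb K c d y| ≤ (∑ k ∈ K, |c k| * d k ^ (-σ)) * y ^ σ := by
  rw [fractComb, sum_mul]
  refine (abs_sum_le_sum_abs _ _).trans (sum_le_sum fun k hk => ?_)
  have hdk := hd k hk
  rw [abs_mul, abs_of_nonneg (Int.fract_nonneg ((d k)⁻¹ * y)), mul_assoc]
  gcongr
  refine (fract_le_rpow h0 h1 (by positivity)).trans_eq ?_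
  rw [Real.mul_rpow (by positivity) hy.le, Real.inv_rpow hdk.le, Real.rpow_neg hdk.le]

/-- Comparison of the Mellin transform with bounds for the function on three ranges. -/
lemma norm_sum_mul_fractMellin_le (hd : ∀ k ∈ K, 0 < d k) {σ τ σ₁ σ₂ a b ε A₁ A₂ : ℝ}
    (h0 : 0 < σ) (h1 : σ < 1) (hσ₁ : σ < σ₁) (hσ₂ : σ₂ < σ) (ha : 0 < a) (hab : a ≤ b)
    (hε : 0 ≤ ε) (hA₁ : ∀ t, 0 < t → |fractComb K c d t| ≤ A₁ * t ^ σ₁)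
    (hA₂ : ∀ t, 0 < t → |fractComb K c d t| ≤ A₂ * t ^ σ₂)
    (hmid : ∀ t, a < t → t ≤ b → |fractComb K c d t| ≤ ε * t) :
    ‖∑ k ∈ K, (c k : ℂ) * (d k : ℂ) ^ (-(⟨σ, -τ⟩ : ℂ))‖ * ‖fractMellin ⟨σ, -τ⟩‖ ≤
      A₁ * (a ^ (σ₁ - σ) / (σ₁ - σ)) + ε * (b ^ (1 - σ) / (1 - σ)) +
        A₂ * (b ^ (σ₂ - σ) / (σ - σ₂)) := by
  have hb : 0 < b := ha.trans_le hab
  set s : ℂ := ⟨σ, -τ⟩ with hs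
  obtain ⟨hconv, hval⟩ := hasMellin_fractComb (c := c) hd (s := s) h0 h1
  rw [← norm_mul, ← hval, mellin]
  rw [MellinConvergent] at hconv
  refine (norm_integral_le_integral_norm _).trans ?_
  have hn : IntegrableOn (fun t : ℝ => |fractComb K c d t| * t ^ (-σ - 1)) (Ioi 0) := by
    refine IntegrableOn.congr_fun hconv.norm (fun t ht => ?_) measurableSet_Ioi
    rw [norm_smul, Complex.norm_cpow_eq_rpow_re_of_pos ht, Complex.norm_real, Real.norm_eq_abs,
      mul_comm]
    congr 2
  have heq : ∫ t in Ioi (0 : ℝ), ‖(t : ℂ) ^ (-s - 1) • (fractComb K c d t : ℂ)‖ =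
      ∫ t in Ioi (0 : ℝ), |fractComb K c d t| * t ^ (-σ - 1) := by
    refine setIntegral_congr_fun measurableSet_Ioi fun t ht => ?_
    rw [norm_smul, Complex.norm_cpow_eq_rpow_re_of_pos ht, Complex.norm_real, Real.norm_eq_abs,
      mul_comm]
    congr 2
  rw [heq, ← Ioc_union_Ioi_eq_Ioi hb.le, ← Ioc_union_Ioc_eq_Ioc ha.le hab]
  have hn1 := hn.mono_set (Ioc_subset_Ioi_self : Ioc 0 a ⊆ Ioi 0)
  have hn2 := hn.mono_set (Ioc_subset_Ioi_self.trans (Ioi_subset_Ioi ha.le) : Ioc a b ⊆ Ioi 0)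
  have hn3 := hn.mono_set (Ioi_subset_Ioi hb.le)
  rw [setIntegral_union (by
      rw [Ioc_union_Ioc_eq_Ioc ha.le hab]; exact Ioc_disjoint_Ioi le_rfl) measurableSet_Ioi
      (hn1.union hn2) hn3,
    setIntegral_union (Ioc_disjoint_Ioc_of_le le_rfl) measurableSet_Ioc hn1 hn2]
  have hI1 : ∀ r : ℝ, -1 < r → ∀ w : ℝ, 0 < w → IntegrableOn (fun t : ℝ => t ^ r) (Ioc 0 w) :=
    fun r hr w hw => (intervalIntegrable_iff_integrableOn_Ioc_of_le hw.le).1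
      (intervalIntegral.intervalIntegrable_rpow' hr)
  have hV1 : ∀ r : ℝ, -1 < r → ∀ w : ℝ, 0 < w → ∫ t in Ioc 0 w, t ^ r = w ^ (r + 1) / (r + 1) := by
    intro r hr w hw
    rw [← intervalIntegral.integral_of_le hw.le, integral_rpow (Or.inl hr),
      Real.zero_rpow (by linarith), sub_zero]
  gcongr
  · calc _ ≤ ∫ t in Ioc 0 a, A₁ * t ^ (σ₁ - σ - 1) := by
          refine setIntegral_mono_on hn1 ((hI1 _ (by linarith) _ ha).const_mul _)
            measurableSet_Ioc fun t ht => ?_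
          rw [show σ₁ - σ - 1 = σ₁ + (-σ - 1) by ring, Real.rpow_add ht.1, ← mul_assoc]
          exact mul_le_mul_of_nonneg_right (hA₁ t ht.1) (Real.rpow_nonneg ht.1.le _)
      _ = _ := by rw [integral_const_mul, hV1 _ (by linarith) _ ha]; simp
  · calc _ ≤ ∫ t in Ioc a b, ε * t ^ (-σ) := by
          refine setIntegral_mono_on hn2 (((hI1 _ (by linarith) _ hb).mono_set
            (Ioc_subset_Ioc_left ha.le)).const_mul _) measurableSet_Ioc fun t ht => ?_
          have ht0 := ha.trans ht.1
          rw [show -σ = 1 + (-σ - 1) by ring, Real.rpow_add ht0, ← mul_assoc, Real.rpow_one]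
          rw [show 1 + (-σ - 1) - 1 = -σ - 1 by ring]
          exact mul_le_mul_of_nonneg_right (hmid t ht.1 ht.2) (Real.rpow_nonneg ht0.le _)
      _ ≤ ∫ t in Ioc 0 b, ε * t ^ (-σ) := by
          refine setIntegral_mono_set ((hI1 _ (by linarith) _ hb).const_mul _) ?_
            (Ioc_subset_Ioc_left ha.le).eventuallyLE
          filter_upwards [ae_restrict_mem measurableSet_Ioc] with t ht
          exact mul_nonneg hε (Real.rpow_nonneg ht.1.le _)
      _ = _ := by
          rw [integral_const_mul, hV1 _ (by linarith) _ hb, neg_add_eq_sub]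
  · calc _ ≤ ∫ t in Ioi b, A₂ * t ^ (σ₂ - σ - 1) := by
          refine setIntegral_mono_on hn3
            ((integrableOn_Ioi_rpow_of_lt (by linarith) hb).const_mul _)
            measurableSet_Ioi fun t ht => ?_
          have ht0 : 0 < t := hb.trans ht
          rw [show σ₂ - σ - 1 = σ₂ + (-σ - 1) by ring, Real.rpow_add ht0, ← mul_assoc]
          exact mul_le_mul_of_nonneg_right (hA₂ t ht0) (Real.rpow_nonneg ht0.le _)
      _ = _ := by
          rw [integral_const_mul, integral_Ioi_rpow_of_lt (by linarith) hb]
          rw [sub_add_cancel, ← neg_sub σ₂ σ, div_neg, neg_div]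

end FractCombination

end SeqDistribution

/-! ### Sums over primes and bounds for the Euler factors. -/

namespace SeqDistribution

open Finset

/-- An elementary Mertens-type bound: sum `log rad(m) ≤ log n` over `m ≤ n`, exchange the sums, and
use `⌊n/p⌋ ≥ n/(2p)` for `p ≤ n`. -/
lemma sum_log_div_prime_le (n : ℕ) :
    ∑ p ∈ (Icc 1 n).filter Nat.Prime, Real.log p / p ≤ 2 * Real.log n := by
  rcases Nat.eq_zero_or_pos n with rfl | hn
  · simp
  have hn' : (0 : ℝ) < n := by exact_mod_cast hn
  have h1 : ∑ m ∈ Icc 1 n, ∑ p ∈ m.primeFactors, Real.log p ≤ n * Real.log n := by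
    calc _ ≤ ∑ m ∈ Icc 1 n, Real.log n := by
          refine sum_le_sum fun m hm => ?_
          obtain ⟨hm1, hm2⟩ := mem_Icc.1 hm
          rw [← Real.log_prod fun p hp => by
            exact_mod_cast (Nat.prime_of_mem_primeFactors hp).ne_zero]
          refine Real.log_le_log (prod_pos fun p hp => by
            exact_mod_cast (Nat.prime_of_mem_primeFactors hp).pos) ?_
          rw [← Nat.cast_prod]
          exact_mod_cast (Nat.le_of_dvd hm1 (Nat.prod_primeFactors_dvd m)).trans hm2
      _ = _ := by simp
  have h2 : ∑ m ∈ Icc 1 n, ∑ p ∈ m.primeFactors, Real.log p =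
      ∑ p ∈ (Icc 1 n).filter Nat.Prime, ((n / p : ℕ) : ℝ) * Real.log p := by
    rw [sum_comm' (t' := (Icc 1 n).filter Nat.Prime) (s' := fun p => (Icc 1 n).filter (p ∣ ·))]
    · refine sum_congr rfl fun p _ => ?_
      rw [sum_const, nsmul_eq_mul, ← Nat.Ioc_filter_dvd_card_eq_div]
      rfl
    · intro m p
      simp only [mem_Icc, Nat.mem_primeFactors, mem_filter]
      constructor
      · rintro ⟨⟨a, b⟩, c, d, -⟩
        exact ⟨⟨⟨a, b⟩, d⟩, ⟨c.one_le, (Nat.le_of_dvd a d).trans b⟩, c⟩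
      · rintro ⟨⟨⟨a, b⟩, d⟩, -, c⟩
        exact ⟨⟨a, b⟩, c, d, by omega⟩
  have h3 : ∑ p ∈ (Icc 1 n).filter Nat.Prime, (n / 2 : ℝ) * (Real.log p / p) ≤
      ∑ p ∈ (Icc 1 n).filter Nat.Prime, ((n / p : ℕ) : ℝ) * Real.log p := by
    refine sum_le_sum fun p hp => ?_
    obtain ⟨hp1, hpp⟩ := mem_filter.1 hp
    obtain ⟨hp1, hpn⟩ := mem_Icc.1 hp1
    have hlog : 0 ≤ Real.log p := Real.log_natCast_nonneg p
    have hp0 : (0 : ℝ) < p := by exact_mod_cast hp1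
    rw [div_mul_div_comm, mul_comm (2 : ℝ), mul_div_mul_comm, mul_comm, div_mul_eq_mul_div,
      mul_comm, mul_div_assoc]
    refine le_trans (le_of_eq ?_) (mul_le_mul_of_nonneg_right
      (show (n : ℝ) / p / 2 ≤ ((n / p : ℕ) : ℝ) from ?_) hlog)
    · ring
    · have hk : 1 ≤ n / p := (Nat.one_le_div_iff hp1).2 hpn
      have hlt : n < p * (n / p + 1) := Nat.lt_mul_div_succ n hp1
      have hlt' : (n : ℝ) < p * ((n / p : ℕ) + 1) := by exact_mod_cast hlt
      have hk' : (1 : ℝ) ≤ ((n / p : ℕ) : ℝ) := by exact_mod_cast hk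
      rw [div_div, div_le_iff₀ (by positivity)]
      nlinarith
  rw [← mul_sum, ← h2] at h3
  have := h3.trans h1
  nlinarith

/-- The sum of reciprocals of primes in `[z^(1-η), z]` is bounded. -/
lemma sum_inv_prime_le {z η : ℝ} (hz : 1 < z) (hη : η ≤ 1 / 100) {P : Finset ℕ}
    (hP : ∀ p ∈ P, p.Prime ∧ z ^ (1 - η) ≤ (p : ℝ) ∧ (p : ℝ) ≤ z) :
    ∑ p ∈ P, (1 : ℝ) / p ≤ 21 / 10 := by
  have hl : 0 < Real.log z := Real.log_pos hz
  have hw : 0 < (1 - η) * Real.log z := mul_pos (by linarith) hl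
  have hsub : P ⊆ (Icc 1 ⌊z⌋₊).filter Nat.Prime := by
    intro p hp
    obtain ⟨h1, -, h3⟩ := hP p hp
    exact mem_filter.2 ⟨mem_Icc.2 ⟨h1.one_le, Nat.le_floor h3⟩, h1⟩
  have h1 : ∑ p ∈ P, (1 : ℝ) / p ≤ ((1 - η) * Real.log z)⁻¹ * ∑ p ∈ P, Real.log p / p := by
    rw [mul_sum]
    refine sum_le_sum fun p hp => ?_
    obtain ⟨h1, h2, -⟩ := hP p hp
    have hp0 : (0 : ℝ) < p := by exact_mod_cast h1.pos
    have : (1 - η) * Real.log z ≤ Real.log p := by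
      rw [← Real.log_rpow (by linarith)]
      exact Real.log_le_log (by positivity) h2
    rw [inv_mul_eq_div, le_div_iff₀ hw, one_div_mul_eq_div]
    gcongr
  have h2 : ∑ p ∈ P, Real.log p / p ≤ 2 * Real.log z := by
    refine (sum_le_sum_of_subset_of_nonneg hsub fun p _ _ =>
      div_nonneg (Real.log_natCast_nonneg p) (Nat.cast_nonneg p)).trans
      ((sum_log_div_prime_le _).trans ?_)
    have : (0 : ℝ) < ⌊z⌋₊ := by exact_mod_cast Nat.floor_pos.2 hz.le
    gcongr
    exact Nat.floor_le (by linarith)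
  refine h1.trans ?_
  rw [inv_mul_le_iff₀ hw]
  nlinarith

/-- Uses `1 + t ≤ e^t` at `t = -X/(1+X)`, together with `X - 2X² ≤ X/(1+X)`, which is where `X ≥
-1/2` enters. -/
lemma exp_le_one_add {X : ℝ} (hX : -(1 / 2) ≤ X) : Real.exp (X - 2 * X ^ 2) ≤ 1 + X := by
  have h1 : 0 < 1 + X := by linarith
  have h2 := Real.add_one_le_exp (-(X / (1 + X)))
  have h3 : -(X / (1 + X)) + 1 = (1 + X)⁻¹ := by field_simp; ring
  rw [h3, Real.exp_neg, inv_le_inv₀ h1 (Real.exp_pos _)] at h2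
  refine le_trans (Real.exp_le_exp.2 ?_) h2
  rw [le_div_iff₀ h1]
  nlinarith [mul_nonneg (sq_nonneg X) (by linarith : (0 : ℝ) ≤ 1 + 2 * X)]

section Local

variable {h : ArithmeticFunction ℝ} {q p : ℕ}

lemma abs_localFactor_le (h1 : ∀ n, 0 ≤ h n ∧ h n ≤ 1) (hp : p.Prime) (k : ℕ) :
    |localFactor h q p k| ≤ 2 := by
  have h2 : (2 : ℝ) ≤ p := by exact_mod_cast hp.two_le
  have hx : (p : ℝ)⁻¹ ≤ 2⁻¹ := inv_anti₀ two_pos h2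
  have hx0 : 0 < (p : ℝ)⁻¹ := by positivity
  have hD : 1 / 2 ≤ 1 - h p / (p : ℝ) := by
    rw [div_eq_mul_inv (h p)]
    nlinarith [h1 p]
  have hDi : (1 - h p / (p : ℝ))⁻¹ ≤ 2 := by
    rw [inv_le_comm₀ (by linarith) two_pos]; linarith
  have hDp : 0 < (1 - h p / (p : ℝ))⁻¹ := inv_pos.2 (by linarith)
  have key : ∀ v : ℝ, |v| ≤ 1 → |v * (1 - h p / (p : ℝ))⁻¹| ≤ 2 := by
    intro v hv
    rw [abs_mul, abs_of_pos hDp]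
    nlinarith [abs_nonneg v]
  unfold localFactor
  split_ifs
  · apply key
    have a := h1 (p ^ k)
    have b := h1 (p ^ (k + 1))
    rw [div_eq_mul_inv, abs_le]
    constructor <;> nlinarith
  · apply key
    have a := h1 (p ^ q.factorization p)
    rw [one_div, abs_le]
    constructor <;> nlinarith

lemma abs_localDiff_le (h1 : ∀ n, 0 ≤ h n ∧ h n ≤ 1) (hp : p.Prime) (j : ℕ) :
    |localDiff h q p j| ≤ 4 := by
  cases j with
  | zero => simp [localDiff]
  | succ j =>
    refine (abs_sub _ _).trans ?_
    linarith [abs_localFactor_le (q := q) h1 hp (j + 1), abs_localFactor_le (q := q) h1 hp j]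

/-- Isolates the leading coefficient: each Euler factor is `1 - (1-h(p))p^(-s)` up to second order
terms. -/
lemma abs_localDiff_one_add_le (hm : h.IsMultiplicative) (h1 : ∀ n, 0 ≤ h n ∧ h n ≤ 1)
    (hq : 0 < q.factorization p) (hp : p.Prime) :
    |localDiff h q p 1 + (1 - h p)| ≤ 2 * (p : ℝ)⁻¹ := by
  have h2 : (2 : ℝ) ≤ p := by exact_mod_cast hp.two_le
  have hx : (p : ℝ)⁻¹ ≤ 2⁻¹ := inv_anti₀ two_pos h2
  have hx0 : 0 < (p : ℝ)⁻¹ := by positivity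
  have hD : 1 / 2 ≤ 1 - h p * (p : ℝ)⁻¹ := by nlinarith [h1 p]
  -- The two branches of the local factor have the same shape, with `b = h(p²)` if `p² ∣ q` and `b =
  -- h(p)` otherwise.
  obtain ⟨b, hb0, hb1, hb⟩ : ∃ b : ℝ, 0 ≤ b ∧ b ≤ 1 ∧
      localFactor h q p 1 = (h p - b * (p : ℝ)⁻¹) * (1 - h p * (p : ℝ)⁻¹)⁻¹ := by
    by_cases he : 1 < q.factorization p
    · exact ⟨_, (h1 (p ^ 2)).1, (h1 (p ^ 2)).2, by simp [localFactor, he, div_eq_mul_inv]⟩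
    · have he1 : q.factorization p = 1 := by omega
      refine ⟨_, (h1 p).1, (h1 p).2, ?_⟩
      simp only [localFactor, he1, lt_irrefl, if_false, pow_one, div_eq_mul_inv]
      ring
  have hval : localDiff h q p 1 + (1 - h p) =
      (p : ℝ)⁻¹ * ((h p ^ 2 - b) * (1 - h p * (p : ℝ)⁻¹)⁻¹) := by
    have hne : (1 - h p * (p : ℝ)⁻¹) ≠ 0 := by linarith
    rw [localDiff, localFactor_zero hm h1 hq hp, hb, ← sub_eq_zero]
    generalize (p : ℝ)⁻¹ = x at *
    field_simp
    ring
  have hDi : (1 - h p * (p : ℝ)⁻¹)⁻¹ ≤ 2 := by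
    rw [inv_le_comm₀ (by linarith) two_pos]; linarith
  have hDp : 0 < (1 - h p * (p : ℝ)⁻¹)⁻¹ := inv_pos.2 (by linarith)
  have hv : |h p ^ 2 - b| ≤ 1 := by
    have := h1 p
    rw [abs_le]; constructor <;> nlinarith
  rw [hval, abs_mul, abs_mul, abs_of_pos hx0, abs_of_pos hDp, mul_comm]
  gcongr
  nlinarith [abs_nonneg (h p ^ 2 - b)]

lemma sum_range_pow_le {r : ℝ} (h0 : 0 ≤ r) (h1 : r ≤ 1 / 10) (m : ℕ) :
    ∑ j ∈ range m, 4 * r ^ (j + 2) ≤ 8 * r ^ 2 := by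
  have h : ∑ j ∈ range m, r ^ j ≤ (1 - r)⁻¹ := by
    rw [← tsum_geometric_of_lt_one h0 (by linarith)]
    exact (summable_geometric_of_lt_one h0 (by linarith)).sum_le_tsum _ fun _ _ => by positivity
  have h' : (1 - r)⁻¹ ≤ 2 := by rw [inv_le_comm₀ (by linarith) two_pos]; linarith
  calc _ = 4 * r ^ 2 * ∑ j ∈ range m, r ^ j := by
        rw [mul_sum]; exact sum_congr rfl fun j _ => by ring
    _ ≤ 4 * r ^ 2 * 2 := by gcongr; exact h.trans h'
    _ = _ := by ring

lemma sum_abs_localDiff_le (hm : h.IsMultiplicative) (h1 : ∀ n, 0 ≤ h n ∧ h n ≤ 1)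
    (hq : 0 < q.factorization p) (hp : p.Prime) {r : ℝ} (hr : (p : ℝ)⁻¹ ≤ r) (hr1 : r ≤ 1 / 10) :
    ∑ j ∈ range (q.factorization p + 1), |localDiff h q p j| * r ^ j ≤
      Real.exp ((1 - h p) * r + 12 * r ^ 2) := by
  have hx0 : 0 < (p : ℝ)⁻¹ := inv_pos.2 (by exact_mod_cast hp.pos)
  obtain ⟨m, hm'⟩ : ∃ m, q.factorization p = m + 1 := ⟨_, (Nat.succ_pred_eq_of_pos hq).symm⟩
  rw [hm', sum_range_succ', sum_range_succ']
  have hb := abs_localDiff_one_add_le hm h1 hq hp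
  have hb' : |localDiff h q p 1| ≤ (1 - h p) + 2 * r := by
    have hh := h1 p
    rw [abs_le] at hb ⊢
    constructor <;> linarith
  have hg : ∑ j ∈ range m, |localDiff h q p (j + 1 + 1)| * r ^ (j + 1 + 1) ≤ 8 * r ^ 2 := by
    refine le_trans (sum_le_sum fun j _ => ?_) (sum_range_pow_le (by linarith) hr1 m)
    have : 0 ≤ r ^ (j + 2) := pow_nonneg (by linarith) _
    exact mul_le_mul_of_nonneg_right (abs_localDiff_le h1 hp _) this
  have := Real.add_one_le_exp ((1 - h p) * r + 12 * r ^ 2)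
  have hmul : |localDiff h q p 1| * r ≤ ((1 - h p) + 2 * r) * r :=
    mul_le_mul_of_nonneg_right hb' (by linarith)
  simp only [zero_add, pow_one, pow_zero, mul_one, localDiff, abs_one]
  simp only [localDiff] at hg hmul
  nlinarith [sq_nonneg r]

/-- Bound the real part: `-(1-h(p)) Re ζ` gains `κ(1-h(p))r`, while the error in the first
coefficient costs `2r²` and the higher powers `8r²`. Passing from `1+X` to an exponential costs `2X²
≤ 2r²`, hence the `12`. -/
lemma norm_sum_localDiff_ge (hm : h.IsMultiplicative) (h1 : ∀ n, 0 ≤ h n ∧ h n ≤ 1)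
    (hq : 0 < q.factorization p) (hp : p.Prime) {r : ℝ} (hr : (p : ℝ)⁻¹ ≤ r) (hr1 : r ≤ 1 / 10)
    {κ : ℝ} (hκ0 : 0 ≤ κ) (hκ1 : κ ≤ 1) {ζ : ℂ} (hζ : ‖ζ‖ = r) (hre : ζ.re ≤ -(κ * r)) :
    Real.exp (κ * ((1 - h p) * r) - 12 * r ^ 2) ≤
      ‖∑ j ∈ range (q.factorization p + 1), (localDiff h q p j : ℂ) * ζ ^ j‖ := by
  have hx0 : 0 < (p : ℝ)⁻¹ := inv_pos.2 (by exact_mod_cast hp.pos)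
  have hr0 : 0 < r := by linarith
  obtain ⟨m, hm'⟩ : ∃ m, q.factorization p = m + 1 := ⟨_, (Nat.succ_pred_eq_of_pos hq).symm⟩
  rw [hm', sum_range_succ', sum_range_succ']
  have hb := abs_localDiff_one_add_le hm h1 hq hp
  have hh := h1 p
  set w := localDiff h q p 1 with hw
  have hg : ‖∑ j ∈ range m, (localDiff h q p (j + 1 + 1) : ℂ) * ζ ^ (j + 1 + 1)‖ ≤ 8 * r ^ 2 := by
    refine (norm_sum_le _ _).trans
      (le_trans (sum_le_sum fun j _ => ?_) (sum_range_pow_le hr0.le hr1 m))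
    rw [norm_mul, norm_pow, hζ, Complex.norm_real, Real.norm_eq_abs]
    exact mul_le_mul_of_nonneg_right (abs_localDiff_le h1 hp _) (by positivity)
  have hg' := (abs_le.1 ((Complex.abs_re_le_norm _).trans hg)).1
  have hζ' := (abs_le.1 ((Complex.abs_re_le_norm ζ).trans hζ.le))
  have hwre : (1 - h p) * (κ * r) - 2 * r ^ 2 ≤ w * ζ.re := by
    have e1 : w * ζ.re = (w + (1 - h p)) * ζ.re + (1 - h p) * (-ζ.re) := by ring
    have e2 : |(w + (1 - h p)) * ζ.re| ≤ 2 * r * r := by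
      rw [abs_mul]
      exact mul_le_mul (hb.trans (by linarith)) (abs_le.2 hζ') (abs_nonneg _) (by linarith)
    have e3 := (abs_le.1 e2).1
    have e4 : (1 - h p) * (κ * r) ≤ (1 - h p) * (-ζ.re) :=
      mul_le_mul_of_nonneg_left (by linarith) (by linarith)
    rw [e1]; nlinarith
  set X := κ * ((1 - h p) * r) - 10 * r ^ 2 with hX
  have hk0 : 0 ≤ κ * ((1 - h p) * r) :=
    mul_nonneg hκ0 (mul_nonneg (by linarith) hr0.le)
  have hk1 : κ * ((1 - h p) * r) ≤ r := by
    have : (1 - h p) * r ≤ r := by nlinarith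
    nlinarith [mul_nonneg (by linarith : 0 ≤ 1 - h p) hr0.le]
  have hrr : 10 * r ^ 2 ≤ r := by nlinarith
  have hX2 : X ^ 2 ≤ r ^ 2 := by
    apply sq_le_sq'
    · linarith
    · nlinarith [sq_nonneg r]
  calc _ ≤ Real.exp (X - 2 * X ^ 2) := Real.exp_le_exp.2 (by linarith)
    _ ≤ 1 + X := exp_le_one_add (by linarith)
    _ ≤ (∑ j ∈ range m, (localDiff h q p (j + 1 + 1) : ℂ) * ζ ^ (j + 1 + 1) +
        (localDiff h q p (0 + 1) : ℂ) * ζ ^ (0 + 1) + (localDiff h q p 0 : ℂ) * ζ ^ 0).re := by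
        rw [Complex.add_re, Complex.add_re, zero_add, ← hw, pow_one, Complex.re_ofReal_mul]
        simp only [localDiff, pow_zero, mul_one, Complex.ofReal_one, Complex.one_re]
        simp only [localDiff] at hg'
        rw [hX]
        nlinarith
    _ ≤ _ := Complex.re_le_norm _

end Local

/-- The completely multiplicative function `n ↦ n^(-σ)`. -/
def rpowHom (σ : ℝ) : ℕ →* ℝ where
  toFun n := (n : ℝ) ^ (-σ)
  map_one' := by simp
  map_mul' m n := by simp [Real.mul_rpow]

/-- The completely multiplicative function `n ↦ n^(-s)`. -/
def cpowHom (s : ℂ) : ℕ →* ℂ where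
  toFun n := (n : ℂ) ^ (-s)
  map_one' := by simp
  map_mul' m n := by simp [Complex.natCast_mul_natCast_cpow]

section Global

variable {h : ArithmeticFunction ℝ} {q : ℕ} {σ : ℝ}

lemma inv_le_rpow_neg {p : ℕ} (hp : p.Prime) (hσ : σ ≤ 1) : (p : ℝ)⁻¹ ≤ (p : ℝ) ^ (-σ) := by
  rw [← Real.rpow_neg_one]
  exact Real.rpow_le_rpow_of_exponent_le (by exact_mod_cast hp.one_le) (by linarith)

lemma sum_abs_expCoeff_le (hm : h.IsMultiplicative) (h1 : ∀ n, 0 ≤ h n ∧ h n ≤ 1) (hσ : σ ≤ 1)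
    (hr : ∀ p ∈ q.primeFactors, (p : ℝ) ^ (-σ) ≤ 1 / 10) :
    ∑ k ∈ exponents q, |expCoeff h q k| * (expVal q k : ℝ) ^ (-σ) ≤
      Real.exp (∑ p ∈ q.primeFactors, (1 - h p) * (p : ℝ) ^ (-σ) +
        12 * ∑ p ∈ q.primeFactors, ((p : ℝ) ^ (-σ)) ^ 2) := by
  have := sum_exponents q (fun p j => |localDiff h q p j|) (rpowHom σ)
  simp only [expCoeff, abs_prod]
  refine this.trans_le ?_
  rw [mul_sum, ← sum_add_distrib, Real.exp_sum]
  refine prod_le_prod (fun p _ => sum_nonneg fun j _ => ?_) fun p hp => ?_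
  · exact mul_nonneg (abs_nonneg _) (pow_nonneg (Real.rpow_nonneg (Nat.cast_nonneg _) _) _)
  · have hpp := Nat.prime_of_mem_primeFactors hp
    exact sum_abs_localDiff_le hm h1 (factorization_pos_of_mem hp) hpp (inv_le_rpow_neg hpp hσ)
      (hr p hp)

/-- To be compared with `sum_abs_expCoeff_le`: if every `p^(iτ)` is close to `-1`, then `κ` is close
to `1` and almost nothing is lost against the sum of absolute values. -/
lemma norm_sum_expCoeff_ge (hm : h.IsMultiplicative) (h1 : ∀ n, 0 ≤ h n ∧ h n ≤ 1) (hσ : σ ≤ 1)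
    (hr : ∀ p ∈ q.primeFactors, (p : ℝ) ^ (-σ) ≤ 1 / 10) {κ τ : ℝ} (hκ0 : 0 ≤ κ) (hκ1 : κ ≤ 1)
    (hτ : ∀ p ∈ q.primeFactors, Real.cos (τ * Real.log p) ≤ -κ) :
    Real.exp (κ * ∑ p ∈ q.primeFactors, (1 - h p) * (p : ℝ) ^ (-σ) -
        12 * ∑ p ∈ q.primeFactors, ((p : ℝ) ^ (-σ)) ^ 2) ≤
      ‖∑ k ∈ exponents q, (expCoeff h q k : ℂ) * ((expVal q k : ℝ) : ℂ) ^ (-(⟨σ, -τ⟩ : ℂ))‖ := by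
  have := sum_exponents q (fun p j => (localDiff h q p j : ℂ)) (cpowHom ⟨σ, -τ⟩)
  simp only [expCoeff, Complex.ofReal_prod, Complex.ofReal_natCast]
  refine le_trans ?_ (congrArg norm this).ge
  rw [mul_sum, mul_sum, ← sum_sub_distrib, Real.exp_sum, norm_prod]
  refine prod_le_prod (fun p _ => (Real.exp_pos _).le) fun p hp => ?_
  have hpp := Nat.prime_of_mem_primeFactors hp
  have hp0 : (0 : ℝ) < p := by exact_mod_cast hpp.pos
  refine norm_sum_localDiff_ge hm h1 (factorization_pos_of_mem hp) hpp (inv_le_rpow_neg hpp hσ)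
      (hr p hp) hκ0 hκ1 ?_ ?_
  · change ‖(p : ℂ) ^ (-(⟨σ, -τ⟩ : ℂ))‖ = _
    rw [Complex.norm_natCast_cpow_of_pos hpp.pos]
    rfl
  · change ((p : ℂ) ^ (-(⟨σ, -τ⟩ : ℂ))).re ≤ _
    have hre : ((p : ℂ) ^ (-(⟨σ, -τ⟩ : ℂ))).re = (p : ℝ) ^ (-σ) * Real.cos (τ * Real.log p) := by
      rw [← Complex.ofReal_natCast, Complex.cpow_def_of_ne_zero (by exact_mod_cast hp0.ne'),
        ← Complex.ofReal_log hp0.le, Complex.exp_re, Real.rpow_def_of_pos hp0]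
      generalize Real.log (p : ℝ) = l
      simp [mul_comm]
    rw [hre]
    nlinarith [mul_le_mul_of_nonneg_left (hτ p hp) (Real.rpow_nonneg hp0.le (-σ))]

end Global

end SeqDistribution

/-! ### Numerical inequalities at the saddle point. -/

namespace SeqDistribution

open Finset

/-- Because `(1 - w + w²/2)(1 + w + w²/2) = 1 + w⁴/4 ≥ 1`. -/
lemma exp_neg_le {w : ℝ} (hw : 0 ≤ w) : Real.exp (-w) ≤ 1 - w + w ^ 2 / 2 := by
  have h1 := Real.quadratic_le_exp_of_nonneg hw
  rw [Real.exp_neg, inv_le_iff_one_le_mul₀ (Real.exp_pos w)]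
  have : 0 ≤ 1 - w + w ^ 2 / 2 := by nlinarith [sq_nonneg (w - 1)]
  nlinarith [mul_le_mul_of_nonneg_left h1 this, sq_nonneg (w ^ 2)]

/-- Numerical data shared by the estimates: `L` stands for `log (2u/η²)`. -/
structure Params (η u L θ : ℝ) : Prop where
  eta_pos : 0 < η
  eta_le : η ≤ 1 / 100
  u_ge : 5 ≤ η ^ 2 * u
  L_ge : 20 ≤ L
  u_ge_exp : Real.exp (L / 2) ≤ u
  theta_eq : θ = 16 * η + 1 / L

namespace Params

variable {η u L θ ξ T : ℝ}

lemma u_pos (P : Params η u L θ) : 0 < u := (Real.exp_pos _).trans_le P.u_ge_exp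

lemma theta_le (P : Params η u L θ) : θ ≤ 21 / 100 := by
  have h1 := P.eta_le
  have : 1 / L ≤ 1 / 20 := one_div_le_one_div_of_le (by norm_num) P.L_ge
  rw [P.theta_eq]; linarith

lemma eta_le_theta (P : Params η u L θ) : 16 * η ≤ θ := by
  have : 0 < 1 / L := by have := P.L_ge; positivity
  rw [P.theta_eq]; linarith

lemma theta_pos (P : Params η u L θ) : 0 < θ := by
  linarith [P.eta_le_theta, P.eta_pos]

/-- The summand `1/L` of `θ` is there for this bound: it makes the argument of the logarithm at most
`66L²`, while `θ²u` exceeds `u/L²`, and `u ≥ e^(L/2) ≥ L⁴/384`. -/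
lemma log_le (P : Params η u L θ) (hξ0 : 0 < ξ) (hξ : ξ ≤ 103 / 100 * L) :
    Real.log (16 * ξ / (θ / 4)) ≤ 26 / 1000 * θ ^ 2 * u := by
  have hL := P.L_ge
  have hL0 : 0 < L := by linarith
  have hθ := P.theta_pos
  have hu := P.u_pos
  have h1L : 0 < 1 / L := by positivity
  have h1 : 16 * ξ / (θ / 4) ≤ 66 * L ^ 2 := by
    rw [div_le_iff₀ (by positivity)]
    have : 1 / L ≤ θ := by rw [P.theta_eq]; linarith [P.eta_pos]
    have h2 : L ≤ L ^ 2 * θ := by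
      calc L = L ^ 2 * (1 / L) := by field_simp
        _ ≤ _ := by gcongr
    nlinarith
  have h2 : Real.log (66 * L ^ 2) ≤ 12 + L / 50 := by
    have e1 : Real.log (66 * L ^ 2) = Real.log 66 + 2 * Real.log 100 + 2 * Real.log (L / 100) := by
      rw [Real.log_mul (by norm_num) (by positivity), Real.log_pow,
        Real.log_div hL0.ne' (by norm_num)]
      push_cast; ring
    have e2 := Real.log_le_sub_one_of_pos (show 0 < L / 100 by positivity)
    have e3 : Real.log 66 + 2 * Real.log 100 ≤ 14 := by
      have : Real.log 66 + 2 * Real.log 100 = Real.log 660000 := by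
        rw [show (2 : ℝ) * Real.log 100 = Real.log (100 ^ 2) by rw [Real.log_pow]; norm_num,
          ← Real.log_mul (by norm_num) (by norm_num)]
        norm_num
      rw [this, Real.log_le_iff_le_exp (by norm_num)]
      have h3 := Real.exp_one_gt_d9
      calc (660000 : ℝ) ≤ 2.7182818283 ^ 14 := by norm_num
        _ ≤ Real.exp 1 ^ 14 := by gcongr
        _ = Real.exp 14 := by rw [← Real.exp_nat_mul]; norm_num
    linarith
  have h3 : L ^ 4 / 384 ≤ u := by
    have e1 := Real.pow_div_factorial_le_exp (L / 2) (by linarith) 4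
    refine le_trans (le_of_eq ?_) (e1.trans P.u_ge_exp)
    simp only [Nat.factorial]
    push_cast; ring
  have h4 : 1280 + L ^ 2 / 384 ≤ θ ^ 2 * u := by
    have e1 : L ^ 2 / 384 ≤ (1 / L) ^ 2 * u := by
      calc L ^ 2 / 384 = (1 / L) ^ 2 * (L ^ 4 / 384) := by field_simp
        _ ≤ _ := by gcongr
    have e2 : 256 * η ^ 2 + (1 / L) ^ 2 ≤ θ ^ 2 := by
      rw [P.theta_eq]; nlinarith [P.eta_pos, mul_pos P.eta_pos h1L]
    have e3 := mul_le_mul_of_nonneg_right e2 hu.le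
    linarith [P.u_ge]
  have h5 := Real.log_le_log (by positivity) h1
  nlinarith [sq_nonneg (L - 150)]

/-- Put `H = (1+θ/2)u` and `δ = θ/4`. To first order the left exponent is `H - δ(H-u)`, a gain of
`θ²u/8`. This outweighs the second order term of about `θ²u/32`, the losses of order `η²u` and `θηu`
(small since `16η ≤ θ`), and the logarithm. -/
lemma near_le (P : Params η u L θ) (hξ0 : 0 < ξ) (hξ : ξ ≤ 103 / 100 * L) (hT : T ≤ η ^ 2 * u) :
    Real.exp (-(θ / 4 * (1 - η))) * ((1 + θ / 2) * u) + T + u * (θ / 4) +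
      Real.log (16 * ξ / (θ / 4)) ≤ (1 - 5 * η ^ 2) * ((1 + θ / 2) * u) - T := by
  have hlog := P.log_le hξ0 hξ
  have hθ := P.theta_pos
  have hu := P.u_pos
  have hη := P.eta_pos
  have hηθ := P.eta_le_theta
  have hθ1 := P.theta_le
  have hw : 0 ≤ θ / 4 * (1 - η) := mul_nonneg (by linarith) (by linarith [P.eta_le])
  have hw1 : θ / 4 * (1 - η) ≤ θ / 4 := by nlinarith
  have h1 := exp_neg_le hw
  have hηη : η ^ 2 ≤ θ ^ 2 / 256 := by nlinarith
  have hθη : θ * η ≤ θ ^ 2 / 16 := by nlinarith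
  have h2 : Real.exp (-(θ / 4 * (1 - η))) ≤ 1 - θ / 4 + θ ^ 2 / 64 + θ ^ 2 / 32 := by
    have : (θ / 4 * (1 - η)) ^ 2 ≤ (θ / 4) ^ 2 := by gcongr
    nlinarith
  have h3 : Real.exp (-(θ / 4 * (1 - η))) * (1 + θ / 2) + 2 * η ^ 2 + θ / 4 +
      26 / 1000 * θ ^ 2 ≤ (1 - 5 * η ^ 2) * (1 + θ / 2) := by
    have e1 := mul_le_mul_of_nonneg_right h2 (by linarith : 0 ≤ 1 + θ / 2)
    have e2 : θ ^ 3 ≤ 21 / 100 * θ ^ 2 := by nlinarith [sq_nonneg θ]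
    have e3 : η ^ 2 * (1 + θ / 2) ≤ θ ^ 2 / 256 * (1 + θ / 2) := by gcongr
    nlinarith
  nlinarith [mul_le_mul_of_nonneg_right h3 hu.le]

/-- The mirror image of `near_le`: `H` is the midpoint of `u` and `(1+θ)u`, so the first order gain
is again `θ²u/8`. -/
lemma far_le (P : Params η u L θ) (hξ0 : 0 < ξ) (hξ : ξ ≤ 103 / 100 * L) (hT : T ≤ η ^ 2 * u) :
    Real.exp (θ / 4) * ((1 + θ / 2) * u) + T + (u * (1 + θ)) * (-(θ / 4)) +
      Real.log (16 * ξ / (θ / 4)) ≤ (1 - 5 * η ^ 2) * ((1 + θ / 2) * u) - T := by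
  have hlog := P.log_le hξ0 hξ
  have hθ := P.theta_pos
  have hu := P.u_pos
  have hη := P.eta_pos
  have hηθ := P.eta_le_theta
  have hθ1 := P.theta_le
  have hηη : η ^ 2 ≤ θ ^ 2 / 256 := by nlinarith
  have h2 : Real.exp (θ / 4) ≤ 1 + θ / 4 + θ ^ 2 / 16 := by
    have := Real.abs_exp_sub_one_sub_id_le (x := θ / 4) (by rw [abs_of_pos] <;> linarith)
    linarith [(abs_le.1 this).2]
  have h3 : Real.exp (θ / 4) * (1 + θ / 2) + 2 * η ^ 2 - (1 + θ) * (θ / 4) +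
      26 / 1000 * θ ^ 2 ≤ (1 - 5 * η ^ 2) * (1 + θ / 2) := by
    have e1 := mul_le_mul_of_nonneg_right h2 (by linarith : 0 ≤ 1 + θ / 2)
    have e2 : θ ^ 3 ≤ 21 / 100 * θ ^ 2 := by nlinarith [sq_nonneg θ]
    have e3 : η ^ 2 * (1 + θ / 2) ≤ θ ^ 2 / 256 * (1 + θ / 2) := by gcongr
    nlinarith
  nlinarith [mul_le_mul_of_nonneg_right h3 hu.le]

/-- Since `θL = 16ηL + 1`, widening the range costs `16ηLu + u`; the extra `u` is paid for by the
main term `H`. Dividing by `1-η` adds about `(5/4)ηLu`, within the allowance `25η`. -/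
lemma mid_le (P : Params η u L θ) (hξ : ξ * (1 - η) ≤ L - 1 / 2) (hT : T ≤ η ^ 2 * u) :
    u * (1 + θ) * ξ ≤ (1 - 5 * η ^ 2) * ((1 + θ / 2) * u) - T + u * (1 + 25 * η) * L := by
  have hθ := P.theta_pos
  have hu := P.u_pos
  have hη := P.eta_pos
  have hη1 := P.eta_le
  have hθ1 := P.theta_le
  have hL := P.L_ge
  have hθL : θ * L = 16 * η * L + 1 := by
    rw [P.theta_eq]; field_simp
  have h1 : (1 + θ) * ξ ≤ (1 + θ + 5 / 4 * η) * (L - 1 / 2) := by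
    have e1 : 1 + θ ≤ (1 + θ + 5 / 4 * η) * (1 - η) := by nlinarith
    rcases le_or_gt ξ 0 with h | h
    · nlinarith
    · calc (1 + θ) * ξ ≤ (1 + θ + 5 / 4 * η) * (1 - η) * ξ := by gcongr
        _ = (1 + θ + 5 / 4 * η) * (ξ * (1 - η)) := by ring
        _ ≤ _ := by gcongr
  have h2 : (1 + θ) * ξ ≤ (1 - 5 * η ^ 2) * (1 + θ / 2) - η ^ 2 + (1 + 25 * η) * L := by
    have : η ^ 2 ≤ 1 / 10000 := by nlinarith
    nlinarith [mul_pos hη (by linarith : 0 < L)]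
  nlinarith [mul_le_mul_of_nonneg_right h2 hu.le]

end Params

section Weights

variable {z η : ℝ} {p : ℕ}

lemma rpow_weight_eq (hp : 0 < p) (l ξ : ℝ) :
    (p : ℝ) ^ (-(1 - ξ / l)) = Real.exp (ξ * (Real.log p / l)) / p := by
  have hp0 : (0 : ℝ) < p := by exact_mod_cast hp
  rw [show -(1 - ξ / l) = ξ / l - 1 by ring, Real.rpow_sub_one hp0.ne', Real.rpow_def_of_pos hp0]
  congr 2
  ring

/-- The primes under consideration: those with `log p / log z ∈ [1 - η, 1]`. -/
lemma log_div_log_mem (hz : 0 < Real.log z) (hp : p.Prime) (h1 : z ^ (1 - η) ≤ (p : ℝ))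
    (h2 : (p : ℝ) ≤ z) : 1 - η ≤ Real.log p / Real.log z ∧ Real.log p / Real.log z ≤ 1 := by
  have hp0 : (0 : ℝ) < p := by exact_mod_cast hp.pos
  have hz0 : 0 < z := hp0.trans_le h2
  constructor
  · rw [le_div_iff₀ hz, ← Real.log_rpow hz0]
    exact Real.log_le_log (by positivity) h1
  · rw [div_le_one hz]
    exact Real.log_le_log hp0 h2

end Weights

end SeqDistribution

/-! ### The weighted prime sum and its saddle point. -/

namespace SeqDistribution

open Finset

/-- The weighted prime sum `∑_{p ∣ q} (1 - h(p)) p^(-(1 - ξ/l))`. -/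
def primeSum (h : ArithmeticFunction ℝ) (q : ℕ) (l ξ : ℝ) : ℝ :=
  ∑ p ∈ q.primeFactors, (1 - h p) * (p : ℝ) ^ (-(1 - ξ / l))

/-- Every prime factor of `q` lies in `[z^(1-η), z]`. -/
def PrimesIn (q : ℕ) (z η : ℝ) : Prop :=
  ∀ p ∈ q.primeFactors, z ^ (1 - η) ≤ (p : ℝ) ∧ (p : ℝ) ≤ z

section

variable {h : ArithmeticFunction ℝ} {q : ℕ} {z η ξ : ℝ}

lemma PrimesIn.log_mem (hP : PrimesIn q z η) (hz : 0 < Real.log z) {p : ℕ}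
    (hp : p ∈ q.primeFactors) :
    1 - η ≤ Real.log p / Real.log z ∧ Real.log p / Real.log z ≤ 1 :=
  log_div_log_mem hz (Nat.prime_of_mem_primeFactors hp) (hP p hp).1 (hP p hp).2

lemma PrimesIn.sum_inv_le (hP : PrimesIn q z η) (hz : 0 < Real.log z) (hη : η ≤ 1 / 100) :
    ∑ p ∈ q.primeFactors, (1 : ℝ) / p ≤ 21 / 10 := by
  rcases q.primeFactors.eq_empty_or_nonempty with h0 | ⟨p, hp⟩
  · rw [h0]; norm_num
  · have hp0 : (0 : ℝ) < p := by exact_mod_cast (Nat.prime_of_mem_primeFactors hp).pos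
    have hz1 : 1 < z := (Real.log_pos_iff (hp0.le.trans (hP p hp).2)).1 hz
    exact sum_inv_prime_le hz1 hη fun p hp => ⟨Nat.prime_of_mem_primeFactors hp, hP p hp⟩

/-- All `log p / log z` lie in `[1-η, 1]`, so a shift of `ξ` multiplies every term by nearly the
same factor. One prescribed value of the sum therefore controls it at the neighbouring points. -/
lemma primeSum_shift_le (h1 : ∀ n, 0 ≤ h n ∧ h n ≤ 1) (hP : PrimesIn q z η)
    (hz : 0 < Real.log z) {δ c : ℝ} (hc : ∀ t, 1 - η ≤ t → t ≤ 1 → δ * t ≤ c) :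
    primeSum h q (Real.log z) (ξ + δ) ≤ Real.exp c * primeSum h q (Real.log z) ξ := by
  rw [primeSum, primeSum, mul_sum]
  refine sum_le_sum fun p hp => ?_
  have hpp := (Nat.prime_of_mem_primeFactors hp).pos
  obtain ⟨ha, hb⟩ := hP.log_mem hz hp
  rw [rpow_weight_eq hpp, rpow_weight_eq hpp, add_mul, Real.exp_add]
  have := Real.exp_le_exp.2 (hc _ ha hb)
  have hh : 0 ≤ 1 - h p := by linarith [(h1 p).2]
  calc _ = Real.exp (δ * (Real.log p / Real.log z)) *
        ((1 - h p) * (Real.exp (ξ * (Real.log p / Real.log z)) / p)) := by ring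
    _ ≤ _ := by gcongr

lemma weight_le_inv (hP : PrimesIn q z η) (hz : 0 < Real.log z) (hξ : 0 ≤ ξ) {p : ℕ}
    (hp : p ∈ q.primeFactors) :
    (p : ℝ) ^ (-(1 - ξ / Real.log z)) ≤ Real.exp ξ * (1 / p) := by
  obtain ⟨ha, hb⟩ := hP.log_mem hz hp
  rw [rpow_weight_eq (Nat.prime_of_mem_primeFactors hp).pos, mul_one_div]
  gcongr
  nlinarith

lemma weight_le (hP : PrimesIn q z η) (hz : 0 < Real.log z) (hξ : 0 ≤ ξ) {p : ℕ}
    (hp : p ∈ q.primeFactors) :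
    (p : ℝ) ^ (-(1 - ξ / Real.log z)) ≤ Real.exp (ξ - (1 - η) * Real.log z) := by
  have hp0 : (0 : ℝ) < p := by exact_mod_cast (Nat.prime_of_mem_primeFactors hp).pos
  have hl := (hP.log_mem hz hp).1
  rw [le_div_iff₀ hz] at hl
  refine (weight_le_inv hP hz hξ hp).trans ?_
  rw [Real.exp_sub, mul_one_div]
  gcongr
  exact (Real.le_log_iff_exp_le hp0).1 hl

lemma sum_weight_sq_le (hP : PrimesIn q z η) (hz : 0 < Real.log z) (hη : η ≤ 1 / 100)
    (hξ : 0 ≤ ξ) :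
    12 * ∑ p ∈ q.primeFactors, ((p : ℝ) ^ (-(1 - ξ / Real.log z))) ^ 2 ≤
      26 * Real.exp (2 * ξ - (1 - η) * Real.log z) := by
  have h1 : ∑ p ∈ q.primeFactors, ((p : ℝ) ^ (-(1 - ξ / Real.log z))) ^ 2 ≤
      Real.exp (2 * ξ - (1 - η) * Real.log z) * ∑ p ∈ q.primeFactors, (1 : ℝ) / p := by
    rw [mul_sum]
    refine sum_le_sum fun p hp => ?_
    calc ((p : ℝ) ^ (-(1 - ξ / Real.log z))) ^ 2
        ≤ Real.exp (ξ - (1 - η) * Real.log z) * (Real.exp ξ * (1 / p)) := by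
          rw [sq]
          exact mul_le_mul (weight_le hP hz hξ hp) (weight_le_inv hP hz hξ hp)
            (Real.rpow_nonneg (Nat.cast_nonneg _) _) (Real.exp_pos _).le
      _ = _ := by
          rw [← mul_assoc, ← Real.exp_add]; ring_nf
  have h2 := hP.sum_inv_le hz hη
  have := mul_le_mul_of_nonneg_left h2 (Real.exp_pos (2 * ξ - (1 - η) * Real.log z)).le
  nlinarith [Real.exp_pos (2 * ξ - (1 - η) * Real.log z)]

lemma primeSum_zero (l : ℝ) :
    primeSum h q l 0 = ∑ p ∈ q.primeFactors, (1 - h p) / (p : ℝ) := by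
  simp [primeSum, div_eq_mul_inv, Real.rpow_neg_one]

lemma primeSum_le (h1 : ∀ n, 0 ≤ h n ∧ h n ≤ 1) (hP : PrimesIn q z η) (hz : 0 < Real.log z)
    (hη : η ≤ 1 / 100) (hξ : 0 ≤ ξ) : primeSum h q (Real.log z) ξ ≤ Real.exp ξ * (21 / 10) := by
  have e1 := primeSum_shift_le (ξ := 0) (δ := ξ) (c := ξ) h1 hP hz fun t _ ht => by nlinarith
  rw [zero_add, primeSum_zero] at e1
  refine e1.trans (mul_le_mul_of_nonneg_left (le_trans ?_ (hP.sum_inv_le hz hη))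
    (Real.exp_pos _).le)
  refine sum_le_sum fun p _ => ?_
  have := (h1 p).1
  gcongr
  linarith

lemma le_primeSum (h1 : ∀ n, 0 ≤ h n ∧ h n ≤ 1) (hP : PrimesIn q z η) (hz : 0 < Real.log z)
    (hξ : 0 ≤ ξ) (hG : η ^ 2 ≤ ∑ p ∈ q.primeFactors, (1 - h p) / (p : ℝ)) :
    Real.exp (ξ * (1 - η)) * η ^ 2 ≤ primeSum h q (Real.log z) ξ := by
  have e1 := primeSum_shift_le (ξ := ξ) (δ := -ξ) (c := -(ξ * (1 - η))) h1 hP hz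
    fun t ht _ => by nlinarith
  rw [add_neg_cancel, primeSum_zero, Real.exp_neg, le_inv_mul_iff₀ (Real.exp_pos _)] at e1
  exact (mul_le_mul_of_nonneg_left hG (Real.exp_pos _).le).trans e1

lemma continuous_primeSum (l : ℝ) : Continuous fun ξ => primeSum h q l ξ := by
  refine continuous_finsetSum _ fun p hp => continuous_const.mul ?_
  have hp0 : (p : ℝ) ≠ 0 := by exact_mod_cast (Nat.prime_of_mem_primeFactors hp).ne_zero
  exact Continuous.rpow continuous_const (by fun_prop) fun _ => Or.inl hp0

/-- The saddle point: a value of `ξ` at which the weighted prime sum has a prescribed value. -/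
lemma exists_primeSum_eq (h1 : ∀ n, 0 ≤ h n ∧ h n ≤ 1) (hP : PrimesIn q z η)
    (hz : 0 < Real.log z) (hη0 : 0 < η) (hη : η ≤ 1 / 100)
    (hG : η ^ 2 ≤ ∑ p ∈ q.primeFactors, (1 - h p) / (p : ℝ)) {w : ℝ} (hw : 200 ≤ w) :
    ∃ ξ, 4 ≤ ξ ∧ ξ * (1 - η) ≤ Real.log (w / η ^ 2) ∧ primeSum h q (Real.log z) ξ = w := by
  have hwη : 1 ≤ w / η ^ 2 := by
    rw [le_div_iff₀ (by positivity)]; nlinarith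
  have hl := Real.log_nonneg hwη
  set ξ₁ := Real.log (w / η ^ 2) / (1 - η) with hξ₁
  have hη' : 0 < 1 - η := by linarith
  have h0 : 0 ≤ ξ₁ := by positivity
  have hend : ξ₁ * (1 - η) = Real.log (w / η ^ 2) := div_mul_cancel₀ _ hη'.ne'
  have hlow : primeSum h q (Real.log z) 0 ≤ w := by
    have := primeSum_le h1 hP hz hη le_rfl
    rw [Real.exp_zero] at this; linarith
  have hhigh : w ≤ primeSum h q (Real.log z) ξ₁ := by
    have := le_primeSum h1 hP hz h0 hG
    rw [hend, Real.exp_log (by linarith), div_mul_cancel₀ _ (by positivity)] at this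
    exact this
  obtain ⟨ξ, ⟨hξ0, hξ1⟩, hξ⟩ := intermediate_value_Icc h0
    (continuous_primeSum (h := h) (q := q) (Real.log z)).continuousOn ⟨hlow, hhigh⟩
  refine ⟨ξ, ?_, ?_, hξ⟩
  -- If `ξ < 4` the sum is at most `2.1·e^4 < 200 ≤ w`. The bound `ξ ≥ 4 ≥ π` is needed in
  -- `fractMellin_lower`.
  · by_contra hlt
    push Not at hlt
    have e1 := primeSum_le h1 hP hz hη hξ0
    have e2 : Real.exp ξ ≤ Real.exp 4 := Real.exp_le_exp.2 hlt.le
    have e3 : Real.exp 4 ≤ 2.7182818286 ^ 4 := by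
      rw [show (4 : ℝ) = (4 : ℕ) * 1 by norm_num, Real.exp_nat_mul]
      exact pow_le_pow_left₀ (Real.exp_pos 1).le Real.exp_one_lt_d9.le 4
    simp only at hξ
    rw [hξ] at e1
    norm_num at e3
    linarith
  · rw [← hend]; gcongr

end

/-- As `ξ ≥ 4 ≥ π`, the real part of `1/(1-s)` is at least `l/(2ξ)`. The exponentially small tail is
at most `1/4`, hence at most half of this. -/
lemma fractMellin_lower {l ξ : ℝ} (hl : 100 ≤ l) (h4 : 4 ≤ ξ) (hξ : ξ ≤ 65 / 100 * l) :
    l / (4 * ξ) ≤ ‖fractMellin ⟨1 - ξ / l, -(Real.pi / l)⟩‖ := by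
  have hl0 : 0 < l := by linarith
  have hξ0 : 0 < ξ := by linarith
  have hr : ξ / l ≤ 65 / 100 := by rwa [div_le_iff₀ hl0]
  have hr0 : 0 < ξ / l := by positivity
  refine le_trans ?_ (norm_fractMellin_ge (by linarith) (by linarith)
    (show 0 < Real.pi / l by positivity))
  have e1 : (1 - (1 - ξ / l)) / ((1 - (1 - ξ / l)) ^ 2 + (Real.pi / l) ^ 2) =
      l * ξ / (ξ ^ 2 + Real.pi ^ 2) := by
    rw [sub_sub_cancel]
    field_simp
  have e2 : l / (2 * ξ) ≤ l * ξ / (ξ ^ 2 + Real.pi ^ 2) := by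
    have : Real.pi ^ 2 ≤ ξ ^ 2 := by
      have := Real.pi_le_four
      have := Real.pi_pos
      gcongr; linarith
    rw [div_le_div_iff₀ (by positivity) (by positivity)]
    nlinarith
  have e3 : Real.pi * (1 - ξ / l) / (4 * (Real.pi / l)) = (1 - ξ / l) * l / 4 := by
    have := Real.pi_pos
    field_simp
  have e4 : Real.exp (-((1 - ξ / l) * l / 4)) * (2 / (1 - ξ / l)) ≤ 1 / 4 := by
    have a1 : 8 ≤ (1 - ξ / l) * l / 4 := by nlinarith
    have a2 : 2 / (1 - ξ / l) ≤ 6 := by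
      rw [div_le_iff₀ (by linarith)]; linarith
    have a3 : Real.exp (-((1 - ξ / l) * l / 4)) ≤ 1 / 24 := by
      rw [Real.exp_neg, inv_le_comm₀ (Real.exp_pos _) (by norm_num)]
      have b1 := Real.quadratic_le_exp_of_nonneg (show (0 : ℝ) ≤ 8 by norm_num)
      have b2 := Real.exp_le_exp.2 a1
      linarith
    have a4 : 0 ≤ 2 / (1 - ξ / l) := div_nonneg (by norm_num) (by linarith)
    nlinarith [Real.exp_pos (-((1 - ξ / l) * l / 4))]
  have e5 : 1 / 4 ≤ l / (4 * ξ) := by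
    rw [div_le_div_iff₀ (by norm_num) (by positivity)]; linarith
  have e6 : l / (2 * ξ) = l / (4 * ξ) + l / (4 * ξ) := by field_simp; norm_num
  rw [e1, e3]
  linarith

/-- The cosine is stationary at `π`, so primes within `η` of `z` on the logarithmic scale lose only
`O(η²)`; the constant comes from `π²/2 ≤ 5`. -/
lemma cos_pi_mul_le {η t : ℝ} (h1 : 1 - η ≤ t) (h2 : t ≤ 1) :
    Real.cos (Real.pi * t) ≤ -(1 - 5 * η ^ 2) := by
  have e1 : Real.cos (Real.pi * t) = -Real.cos (Real.pi * (1 - t)) := by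
    rw [← Real.cos_pi_sub]; ring_nf
  have e2 := Real.one_sub_sq_div_two_le_cos (x := Real.pi * (1 - t))
  have e3 : (1 - t) ^ 2 ≤ η ^ 2 := by gcongr; linarith
  have e4 : Real.pi ^ 2 ≤ 10 := by
    have := Real.pi_lt_d2
    have := Real.pi_pos
    nlinarith
  have e5 : (Real.pi * (1 - t)) ^ 2 ≤ 10 * η ^ 2 := by
    rw [mul_pow]; exact mul_le_mul e4 e3 (sq_nonneg _) (by norm_num)
  rw [e1]; linarith

/-- The sizes of the parameters, in terms of `l = log z`. -/
lemma error_exponent_le {η u l ξ L : ℝ} (hη0 : 0 < η) (hη : η ≤ 1 / 100) (hu : 0 < u)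
    (hl : 100 ≤ l) (hηl : Real.log (1 / η) ≤ l / 20) (hul : Real.log u ≤ l / 2)
    (hL : L = Real.log (2 * u / η ^ 2)) (hξ : ξ * (1 - η) ≤ L - 1 / 2) {ξ' : ℝ} (hξ0 : 0 ≤ ξ)
    (hξ' : ξ' ≤ ξ + 6 / 100) :
    ξ' ≤ 65 / 100 * l ∧ Real.exp (ξ' - (1 - η) * l) ≤ 1 / 10 ∧
      26 * Real.exp (2 * ξ' - (1 - η) * l) ≤ η ^ 2 * u := by
  have hLe : L = Real.log 2 + Real.log u + 2 * Real.log (1 / η) := by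
    rw [hL, Real.log_div (by positivity) (by positivity), Real.log_mul (by norm_num) hu.ne',
      Real.log_pow, one_div, Real.log_inv]
    push_cast; ring
  have hlog2 := Real.log_two_lt_d9
  set m := Real.log u with hm
  set r := Real.log (1 / η) with hr
  have hA : ξ * (1 - η) ≤ m + 2 * r + 2 / 10 := by linarith
  have hξ1 : ξ ≤ 61 / 100 * l + 1 := by nlinarith
  have hξ2 : ξ ≤ m + 2 * r + 2 / 10 + 1 / 100 * (61 / 100 * l + 1) := by nlinarith
  refine ⟨by linarith, ?_, ?_⟩
  · have : ξ' - (1 - η) * l ≤ -9 := by nlinarith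
    have h9 := Real.add_one_le_exp (9 : ℝ)
    refine (Real.exp_le_exp.2 this).trans ?_
    rw [Real.exp_neg, inv_le_comm₀ (Real.exp_pos _) (by norm_num)]
    linarith
  · have h26 : Real.exp 4 ≥ 26 := by
      have := Real.exp_one_gt_d9
      calc Real.exp 4 = Real.exp 1 ^ 4 := by rw [← Real.exp_nat_mul]; norm_num
        _ ≥ 2.7182818283 ^ 4 := by gcongr
        _ ≥ 26 := by norm_num
    have hval : η ^ 2 * u = Real.exp (m - 2 * r) := by
      rw [Real.exp_sub, hm, Real.exp_log hu, hr, two_mul, Real.exp_add,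
        Real.exp_log (by positivity)]
      field_simp
    rw [hval]
    calc _ ≤ Real.exp 4 * Real.exp (2 * ξ' - (1 - η) * l) := by gcongr
      _ = Real.exp (4 + (2 * ξ' - (1 - η) * l)) := (Real.exp_add _ _).symm
      _ ≤ _ := by
          apply Real.exp_le_exp.2
          nlinarith

lemma params_of {η u : ℝ} (hη0 : 0 < η) (hη : η ≤ 1 / 100) (hu : 5 / η ^ 2 ≤ u) :
    Params η u (Real.log (2 * u / η ^ 2)) (16 * η + 1 / Real.log (2 * u / η ^ 2)) := by
  have hη2 : 0 < η ^ 2 := by positivity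
  have h5 : 5 ≤ η ^ 2 * u := by rwa [div_le_iff₀' hη2] at hu
  have hηη : η ^ 2 ≤ 1 / 10000 := by nlinarith
  have hu0 : 50000 ≤ u := by
    by_contra hlt
    push Not at hlt
    nlinarith
  have hupos : 0 < u := by linarith
  refine ⟨hη0, hη, h5, ?_, ?_, rfl⟩
  · rw [Real.le_log_iff_exp_le (by positivity), le_div_iff₀ hη2]
    have e3 : Real.exp 20 ≤ 2.7182818286 ^ 20 := by
      rw [show (20 : ℝ) = (20 : ℕ) * 1 by norm_num, Real.exp_nat_mul]
      exact pow_le_pow_left₀ (Real.exp_pos 1).le Real.exp_one_lt_d9.le 20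
    have e4 : Real.exp 20 ≤ 10 ^ 9 := e3.trans (by norm_num)
    nlinarith [Real.exp_pos 20]
  · have : Real.log (2 * u / η ^ 2) ≤ Real.log (u ^ 2) := by
      apply Real.log_le_log (by positivity)
      rw [div_le_iff₀ hη2]; nlinarith
    rw [Real.log_pow] at this
    rw [← Real.le_log_iff_exp_le hupos]
    push_cast at this
    linarith

end SeqDistribution

/-! ### Oscillation of the summatory function of `f_q`. -/

namespace SeqDistribution

open Finset

lemma log_saddle_le {η u θ : ℝ} (hη : 0 < η) (hu : 0 < u) (hθ0 : 0 < θ) (hθ : θ ≤ 21 / 100) :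
    Real.log ((1 + θ / 2) * u / η ^ 2) ≤ Real.log (2 * u / η ^ 2) - 1 / 2 := by
  have e1 : (1 + θ / 2) * u / η ^ 2 = ((1 + θ / 2) / 2) * (2 * u / η ^ 2) := by ring
  have e2 := Real.log_le_sub_one_of_pos (show 0 < (1 + θ / 2) / 2 * (5 / 3) by positivity)
  have e3 : 9 / 20 ≤ Real.log (5 / 3) := by
    have e4 := Real.one_sub_inv_le_log_of_pos (show (0 : ℝ) < 5 / 4 by norm_num)
    have e5 := Real.one_sub_inv_le_log_of_pos (show (0 : ℝ) < 4 / 3 by norm_num)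
    have e6 : Real.log (5 / 3) = Real.log (5 / 4) + Real.log (4 / 3) := by
      rw [← Real.log_mul (by norm_num) (by norm_num)]; norm_num
    norm_num at e4 e5
    linarith
  rw [Real.log_mul (by positivity) (by norm_num)] at e2
  rw [e1, Real.log_mul (by positivity) (by positivity)]
  linarith

/-- The term `log(16ξ/δ)` is exactly what converts the factor `l/δ` of a tail integral into a
quarter of the main term's `l/(4ξ)`. -/
lemma outer_term_le {A X Y l δ ξ G : ℝ} (hl : 0 < l) (hδ : 0 < δ) (hξ : 0 < ξ)
    (hA : A ≤ Real.exp X) (hG : X + Y + Real.log (16 * ξ / δ) ≤ G) :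
    A * (Real.exp Y / (δ / l)) ≤ 1 / 4 * (Real.exp G * (l / (4 * ξ))) := by
  have h1 := Real.exp_le_exp.2 hG
  rw [Real.exp_add, Real.exp_add, Real.exp_log (by positivity)] at h1
  calc A * (Real.exp Y / (δ / l)) ≤ Real.exp X * (Real.exp Y / (δ / l)) := by gcongr
    _ = Real.exp X * Real.exp Y * (16 * ξ / δ) * (l / (16 * ξ)) := by field_simp
    _ ≤ Real.exp G * (l / (16 * ξ)) := by gcongr
    _ = _ := by field_simp; norm_num

lemma middle_term_le {W X l ξ G : ℝ} (hl : 0 < l) (hξ : 0 < ξ) (hG : W ≤ G + X) :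
    1 / 16 * Real.exp (-X) * (Real.exp W / (ξ / l)) ≤
      1 / 4 * (Real.exp G * (l / (4 * ξ))) := by
  have h1 := Real.exp_le_exp.2 hG
  calc 1 / 16 * Real.exp (-X) * (Real.exp W / (ξ / l))
      ≤ 1 / 16 * Real.exp (-X) * (Real.exp (G + X) / (ξ / l)) := by gcongr
    _ = _ := by rw [Real.exp_add, Real.exp_neg]; field_simp; norm_num

section

variable {h : ArithmeticFunction ℝ} {q : ℕ} {z η : ℝ}

lemma sum_abs_expCoeff_le_exp (hm : h.IsMultiplicative) (h1 : ∀ n, 0 ≤ h n ∧ h n ≤ 1)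
    (hz : 0 < Real.log z) (hη : η ≤ 1 / 100) (hP : PrimesIn q z η) {ξ H T : ℝ} (hξ0 : 0 ≤ ξ)
    (hr : Real.exp (ξ - (1 - η) * Real.log z) ≤ 1 / 10)
    (hT : 26 * Real.exp (2 * ξ - (1 - η) * Real.log z) ≤ T)
    (hH : primeSum h q (Real.log z) ξ ≤ H) :
    ∑ k ∈ exponents q, |expCoeff h q k| * (expVal q k : ℝ) ^ (-(1 - ξ / Real.log z)) ≤
      Real.exp (H + T) := by
  refine (sum_abs_expCoeff_le hm h1 (by linarith [div_nonneg hξ0 hz.le])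
    fun p hp => (weight_le hP hz hξ0 hp).trans hr).trans (Real.exp_le_exp.2 ?_)
  exact add_le_add hH ((sum_weight_sq_le hP hz hη hξ0).trans hT)

lemma norm_sum_expCoeff_ge_exp (hm : h.IsMultiplicative) (h1 : ∀ n, 0 ≤ h n ∧ h n ≤ 1)
    (hz : 0 < Real.log z) (hη0 : 0 < η) (hη : η ≤ 1 / 100) (hP : PrimesIn q z η) {ξ H T : ℝ}
    (hξ0 : 0 ≤ ξ) (hr : Real.exp (ξ - (1 - η) * Real.log z) ≤ 1 / 10)
    (hT : 26 * Real.exp (2 * ξ - (1 - η) * Real.log z) ≤ T)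
    (hH : primeSum h q (Real.log z) ξ = H) :
    Real.exp ((1 - 5 * η ^ 2) * H - T) ≤
      ‖∑ k ∈ exponents q, (expCoeff h q k : ℂ) * ((expVal q k : ℝ) : ℂ) ^
        (-(⟨1 - ξ / Real.log z, -(Real.pi / Real.log z)⟩ : ℂ))‖ := by
  have hη2 : η ^ 2 ≤ 1 / 10000 := by nlinarith
  refine le_trans (Real.exp_le_exp.2 ?_) (norm_sum_expCoeff_ge (κ := 1 - 5 * η ^ 2) hm h1
    (by linarith [div_nonneg hξ0 hz.le]) (fun p hp => (weight_le hP hz hξ0 hp).trans hr)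
    (by linarith) (by nlinarith) fun p hp => ?_)
  · rw [← primeSum, hH]
    exact sub_le_sub_left ((sum_weight_sq_le hP hz hη hξ0).trans hT) _
  · rw [div_mul_eq_mul_div, mul_div_assoc]
    exact cos_pi_mul_le (hP.log_mem hz hp).1 (hP.log_mem hz hp).2

/-- The Mellin transform inequality in exponential coordinates, when the error in the summation of
`f_q` is small throughout `[z^u, z^V]`. -/
lemma mellin_inequality (hm : h.IsMultiplicative) (h1 : ∀ n, 0 ≤ h n ∧ h n ≤ 1) (hq : q ≠ 0)
    (hz0 : 0 < z) (hz : 100 ≤ Real.log z) {u V ξ δ ε : ℝ} (huV : u ≤ V) (hξ : 4 ≤ ξ)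
    (hδ0 : 0 < δ) (hδ1 : δ ≤ ξ) (hξδ : ξ + δ ≤ 65 / 100 * Real.log z) (hε : 0 ≤ ε)
    (hsmall : ∀ y, z ^ u ≤ y → y ≤ z ^ V →
      |∑ s ∈ Icc 1 ⌊y⌋₊, fFun h q s - gammaFactor h q * y| ≤ ε * y) :
    ‖∑ k ∈ exponents q, (expCoeff h q k : ℂ) * ((expVal q k : ℝ) : ℂ) ^
        (-(⟨1 - ξ / Real.log z, -(Real.pi / Real.log z)⟩ : ℂ))‖ * (Real.log z / (4 * ξ)) ≤
      (∑ k ∈ exponents q, |expCoeff h q k| * (expVal q k : ℝ) ^ (-(1 - (ξ - δ) / Real.log z))) *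
        (Real.exp (u * δ) / (δ / Real.log z)) +
      ε * (Real.exp (V * ξ) / (ξ / Real.log z)) +
      (∑ k ∈ exponents q, |expCoeff h q k| * (expVal q k : ℝ) ^ (-(1 - (ξ + δ) / Real.log z))) *
        (Real.exp (V * -δ) / (δ / Real.log z)) := by
  have hM := fractMellin_lower hz hξ (by linarith)
  refine (mul_le_mul_of_nonneg_left hM (norm_nonneg _)).trans ?_
  have hpow : ∀ v t : ℝ, (z ^ v) ^ (t / Real.log z) = Real.exp (v * t) := by
    intro v t
    rw [← Real.rpow_mul hz0.le, Real.rpow_def_of_pos hz0]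
    congr 1
    field_simp
  have hl0 : 0 < Real.log z := by linarith
  have hz1 : 1 ≤ z := (Real.log_nonneg_iff hz0).1 hl0.le
  set l := Real.log z with hl
  have hd : ∀ k ∈ exponents q, (0 : ℝ) < (expVal q k : ℝ) := fun k _ => by
    exact_mod_cast expVal_pos q k
  have hξl0 : 0 < ξ / l := by positivity
  have hδl : 0 < δ / l := by positivity
  have hfl : (ξ + δ) / l ≤ 65 / 100 := by rwa [div_le_iff₀ hl0]
  have hnl : 0 ≤ (ξ - δ) / l := div_nonneg (by linarith) hl0.le
  have hsplit : (ξ + δ) / l = ξ / l + δ / l := add_div _ _ _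
  have hsplit' : (ξ - δ) / l = ξ / l - δ / l := sub_div _ _ _
  -- The larger exponent `σ₁ > σ` makes the integral converge at `0`, the smaller `σ₂ < σ` at
  -- infinity.
  have key := norm_sum_mul_fractMellin_le (c := expCoeff h q) (τ := Real.pi / l)
    (σ := 1 - ξ / l) (σ₁ := 1 - (ξ - δ) / l) (σ₂ := 1 - (ξ + δ) / l)
    (a := z ^ u) (b := z ^ V) (ε := ε) hd (by linarith) (by linarith) (by linarith)
    (by linarith) (by positivity) (Real.rpow_le_rpow_of_exponent_le hz1 huV) hε
    (fun t ht => abs_fractComb_le hd (by linarith) (by linarith) ht)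
    (fun t ht => abs_fractComb_le hd (by linarith) (by linarith) ht)
    (fun t ht ht' => by
      have ht0 : 0 < t := (by positivity : 0 < z ^ u).trans ht
      have := hsmall t ht.le ht'
      rwa [sum_fFun_sub hm h1 hq ht0.le, abs_neg] at this)
  rw [show 1 - (ξ - δ) / l - (1 - ξ / l) = δ / l by rw [hsplit']; ring,
    show 1 - (ξ + δ) / l - (1 - ξ / l) = -δ / l by rw [hsplit]; ring,
    show 1 - ξ / l - (1 - (ξ + δ) / l) = δ / l by rw [hsplit]; ring, sub_sub_cancel,
    hpow, hpow, hpow] at key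
  exact key

end

/-- Oscillation of the summatory function of `f_q` in the range `[z^u, z^(5u/4)]`. -/
theorem exists_large_error {h : ArithmeticFunction ℝ} (hm : h.IsMultiplicative)
    (h1 : ∀ n, 0 ≤ h n ∧ h n ≤ 1) {q : ℕ} (hq : q ≠ 0) {z η u : ℝ} (hz0 : 0 < z)
    (hz : 100 ≤ Real.log z) (hη0 : 0 < η) (hη : η ≤ 1 / 100)
    (hηz : Real.log (1 / η) ≤ Real.log z / 20) (hP : PrimesIn q z η)
    (hG : η ^ 2 ≤ ∑ p ∈ q.primeFactors, (1 - h p) / (p : ℝ)) (hu : 5 / η ^ 2 ≤ u)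
    (huz : Real.log u ≤ Real.log z / 2) :
    ∃ y, z ^ u ≤ y ∧ y ≤ z ^ (5 / 4 * u) ∧
      1 / 16 * Real.exp (-(u * (1 + 25 * η) * Real.log (2 * u / η ^ 2))) * y <
        |∑ s ∈ Icc 1 ⌊y⌋₊, fFun h q s - gammaFactor h q * y| := by
  have Pm := params_of hη0 hη hu
  generalize hθ : 16 * η + 1 / Real.log (2 * u / η ^ 2) = θ at Pm
  have hl0 : 0 < Real.log z := by linarith
  have hz1 : 1 ≤ z := (Real.log_nonneg_iff hz0).1 hl0.le
  have hu0 := Pm.u_pos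
  have hθ0 := Pm.theta_pos
  have hθ1 := Pm.theta_le
  have hw : 200 ≤ (1 + θ / 2) * u := by
    have := Pm.u_ge
    have : η ^ 2 ≤ 1 / 10000 := by nlinarith
    nlinarith
  -- The saddle value `(1+θ/2)u` is the midpoint of `[u, (1+θ)u]`, so both tails gain equally.
  obtain ⟨ξ, h4, hξη, hξ⟩ := exists_primeSum_eq h1 hP hl0 hη0 hη hG hw
  have hξ0 : 0 < ξ := by linarith
  have hξL := hξη.trans (log_saddle_le hη0 hu0 hθ0 hθ1)
  have hξL' : ξ ≤ 103 / 100 * Real.log (2 * u / η ^ 2) := by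
    have := Pm.L_ge
    nlinarith
  -- The allowance `6/100` covers the shift `θ/4 ≤ 21/400`.
  have hsize := fun (ξ' : ℝ) (hξ' : ξ' ≤ ξ + 6 / 100) =>
    error_exponent_le hη0 hη hu0 hz hηz huz rfl hξL hξ0.le hξ'
  obtain ⟨hs1, hs2, hs3⟩ := hsize ξ (by linarith)
  obtain ⟨hn1, hn2, hn3⟩ := hsize (ξ - θ / 4) (by linarith)
  obtain ⟨hf1, hf2, hf3⟩ := hsize (ξ + θ / 4) (by linarith)
  by_contra hcon
  push Not at hcon
  have key := mellin_inequality (V := u * (1 + θ)) (δ := θ / 4) hm h1 hq hz0 hz (by nlinarith) h4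
    (by linarith) (by linarith) hf1 (by positivity) fun y hy hy' =>
      hcon y hy (hy'.trans (Real.rpow_le_rpow_of_exponent_le hz1 (by nlinarith)))
  have hH₁ := primeSum_shift_le (ξ := ξ) (δ := -(θ / 4)) (c := -(θ / 4 * (1 - η))) h1 hP hl0
    fun t ht _ => by nlinarith
  have hH₂ := primeSum_shift_le (ξ := ξ) (δ := θ / 4) (c := θ / 4) h1 hP hl0
    fun t _ ht => by nlinarith
  rw [← sub_eq_add_neg] at hH₁
  rw [hξ] at hH₁ hH₂
  have hlow := norm_sum_expCoeff_ge_exp hm h1 hl0 hη0 hη hP hξ0.le hs2 hs3 hξ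
  have hnear := outer_term_le hl0 (by linarith) hξ0
    (sum_abs_expCoeff_le_exp hm h1 hl0 hη hP (by linarith) hn2 hn3 hH₁)
    (Pm.near_le hξ0 hξL' le_rfl)
  have hfar := outer_term_le hl0 (by linarith) hξ0
    (sum_abs_expCoeff_le_exp hm h1 hl0 hη hP (by linarith) hf2 hf3 hH₂)
    (Pm.far_le hξ0 hξL' le_rfl)
  have hmid := middle_term_le hl0 hξ0 (Pm.mid_le hξL le_rfl)
  have hlower := mul_le_mul_of_nonneg_right hlow
    (show 0 ≤ Real.log z / (4 * ξ) by positivity)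
  have hpos : 0 < Real.exp ((1 - 5 * η ^ 2) * ((1 + θ / 2) * u) - η ^ 2 * u) *
    (Real.log z / (4 * ξ)) := by positivity
  -- Each of the three ranges contributes at most a quarter of the main term, so a positive number
  -- would be at most three quarters of itself.
  have := hlower.trans (key.trans (add_le_add (add_le_add hnear hmid) hfar))
  linarith

end SeqDistribution

/-! ### Maier's matrix and the two discrepancies. -/

namespace SeqDistribution

open Finset

lemma sum_Icc_one_add (a : ℕ → ℝ) (m k : ℕ) :
    ∑ n ∈ Icc 1 (m + k), a n = ∑ n ∈ Icc 1 m, a n + ∑ s ∈ Icc 1 k, a (m + s) := by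
  induction k with
  | zero => simp
  | succ k ih =>
    rw [← add_assoc, sum_Icc_succ_top (by omega), ih, sum_Icc_succ_top (by omega)]
    ring_nf

lemma count_add_sub (a : ℕ → ℝ) (m : ℕ) {y : ℝ} (hy : 0 ≤ y) :
    count a (m + y) - count a m = ∑ s ∈ Icc 1 ⌊y⌋₊, a (m + s) := by
  rw [count, count, Nat.floor_natCast, add_comm, Nat.floor_add_natCast hy, add_comm,
    sum_Icc_one_add]
  ring

lemma countAP_natCast (a : ℕ → ℝ) (m q b : ℕ) :
    countAP a m q b = ∑ n ∈ Icc 1 m, if n ≡ b [MOD q] then a n else 0 := by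
  rw [countAP, Nat.floor_natCast, sum_filter]

lemma countAP_step (a : ℕ → ℝ) {q : ℕ} (hq : 0 < q) (r s : ℕ) :
    countAP a ((r + 1) * q + s : ℕ) q s = countAP a (r * q + s : ℕ) q s + a ((r + 1) * q + s) := by
  rw [countAP_natCast, countAP_natCast, show (r + 1) * q + s = r * q + s + q by ring,
    sum_Icc_one_add, add_right_inj, sum_eq_single q]
  · rw [if_pos]
    simp [Nat.ModEq, show r * q + s + q = s + q * (r + 1) by ring]
  · intro t ht htq
    obtain ⟨h1, h2⟩ := mem_Icc.1 ht
    refine if_neg fun hmod => htq ?_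
    have h3 : t + (s + r * q) ≡ 0 + (s + r * q) [MOD q] := by
      rw [show t + (s + r * q) = r * q + s + t by ring]
      refine hmod.trans ?_
      simp [Nat.ModEq]
    have h4 : q ∣ t := (Nat.modEq_zero_iff_dvd).1 (Nat.ModEq.add_right_cancel' _ h3)
    exact le_antisymm h2 (Nat.le_of_dvd h1 h4)
  · intro hn
    exact absurd (mem_Icc.2 ⟨hq, le_rfl⟩) hn

lemma countAP_sub (a : ℕ → ℝ) {q : ℕ} (hq : 0 < q) (R N s : ℕ) :
    countAP a ((R + N) * q + s : ℕ) q s - countAP a (R * q + s : ℕ) q s =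
      ∑ r ∈ Icc 1 N, a ((R + r) * q + s) := by
  induction N with
  | zero => simp
  | succ N ih =>
    rw [sum_Icc_succ_top (by omega), ← ih, ← add_assoc, countAP_step a hq]
    ring

section Discrepancy

variable {a : ℕ → ℝ} {x : ℝ}

lemma count_nonneg (ha : ∀ n, 0 ≤ a n) (t : ℝ) : 0 ≤ count a t := sum_nonneg fun n _ => ha n

lemma count_mono (ha : ∀ n, 0 ≤ a n) {s t : ℝ} (hst : s ≤ t) : count a s ≤ count a t :=
  sum_le_sum_of_subset_of_nonneg (Icc_subset_Icc_right (Nat.floor_le_floor hst)) fun n _ _ => ha n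

lemma countAP_nonneg (ha : ∀ n, 0 ≤ a n) (t : ℝ) (q b : ℕ) : 0 ≤ countAP a t q b :=
  sum_nonneg fun n _ => ha n

lemma countAP_le_count (ha : ∀ n, 0 ≤ a n) (t : ℝ) (q b : ℕ) : countAP a t q b ≤ count a t :=
  sum_le_sum_of_subset_of_nonneg (filter_subset _ _) fun n _ _ => ha n

lemma abs_fFun_le {h : ArithmeticFunction ℝ} (h1 : ∀ n, 0 ≤ h n ∧ h n ≤ 1) (q b : ℕ) :
    |fFun h q b| ≤ 2 ^ #q.primeFactors := by
  rw [fFun, abs_prod]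
  refine (prod_le_prod (fun _ _ => abs_nonneg _) fun p hp =>
    abs_localFactor_le h1 (Nat.prime_of_mem_primeFactors hp) _).trans_eq ?_
  simp

/-- A real `sSup` dominates its members only if the set is bounded above; the trivial bounds
`𝒜(t;q,b) ≤ 𝒜(x)` and `|f_q| ≤ 2^ω(q)` provide this. -/
lemma le_apDiscrepancy (ha : ∀ n, 0 ≤ a n) (hx : 0 < x) (hA : 0 < count a x)
    {h : ArithmeticFunction ℝ} (h1 : ∀ n, 0 ≤ h n ∧ h n ≤ 1) {q : ℕ} (hq : 0 < q) {t : ℝ}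
    (ht : x / 4 ≤ t) (htx : t ≤ x) (b : ℕ) :
    |countAP a t q b - fFun h q b / ((q : ℝ) * gammaFactor h q) * (t / x) * count a x| ≤
      apDiscrepancy a h x q * (count a x / (Nat.totient q : ℝ)) := by
  have hφ : 0 < count a x / (Nat.totient q : ℝ) :=
    div_pos hA (by exact_mod_cast Nat.totient_pos.2 hq)
  rw [← div_le_iff₀ hφ]
  refine le_csSup ?_ ⟨t, ⟨ht, htx⟩, b, rfl⟩
  have hγ : 0 < (q : ℝ) * gammaFactor h q :=
    mul_pos (by exact_mod_cast hq) (gammaFactor_pos h1 q)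
  refine ⟨(count a x + 2 ^ #q.primeFactors / ((q : ℝ) * gammaFactor h q) * count a x) /
    (count a x / (Nat.totient q : ℝ)), ?_⟩
  rintro _ ⟨s, ⟨hs, hsx⟩, b, rfl⟩
  have hs0 : 0 ≤ s := by linarith
  have hsx1 : s / x ≤ 1 := (div_le_one hx).2 hsx
  gcongr
  refine (abs_sub _ _).trans (add_le_add ?_ ?_)
  · rw [abs_of_nonneg (countAP_nonneg ha _ _ _)]
    exact (countAP_le_count ha _ _ _).trans (count_mono ha hsx)
  · rw [abs_mul, abs_mul, abs_div, abs_of_pos hA, abs_of_pos hγ,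
      abs_of_nonneg (show 0 ≤ s / x by positivity)]
    gcongr
    calc _ ≤ 2 ^ #q.primeFactors / ((q : ℝ) * gammaFactor h q) * 1 := by
          gcongr
          exact abs_fFun_le h1 q b
      _ = _ := mul_one _

lemma apDiscrepancy_nonneg (hA : 0 < count a x) (h : ArithmeticFunction ℝ) (q : ℕ) :
    0 ≤ apDiscrepancy a h x q := by
  refine Real.sSup_nonneg ?_
  rintro _ ⟨s, -, b, rfl⟩
  positivity

lemma le_intervalDiscrepancy (ha : ∀ n, 0 ≤ a n) (hx : 0 < x) (hA : 0 < count a x) {y v : ℝ}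
    (hy : 0 < y) (hv : x / 4 ≤ v) (hvx : v + y ≤ x) :
    |count a (v + y) - count a v - y * (count a x / x)| ≤
      intervalDiscrepancy a x y * (y * (count a x / x)) := by
  have hd : 0 < y * (count a x / x) := by positivity
  rw [← div_le_iff₀ hd]
  refine le_csSup ?_ ⟨v, Set.Ioo_subset_Ioo hv hvx, rfl⟩
  refine ⟨(count a x + y * (count a x / x)) / (y * (count a x / x)), ?_⟩
  rintro _ ⟨w, hw, rfl⟩
  have hwx : w + y ≤ x := ((Set.Ioo_subset_Ioo_iff (by linarith)).1 hw).2
  gcongr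
  refine (abs_sub _ _).trans (add_le_add ?_ (abs_of_pos hd).le)
  rw [abs_of_nonneg (sub_nonneg.2 (count_mono ha (by linarith)))]
  linarith [count_nonneg ha w, count_mono ha hwx]

lemma intervalDiscrepancy_nonneg (hx : 0 < x) (hA : 0 < count a x) {y : ℝ} (hy : 0 < y) :
    0 ≤ intervalDiscrepancy a x y := by
  refine Real.sSup_nonneg ?_
  rintro _ ⟨s, -, rfl⟩
  positivity

/-- Maier's matrix method: the error in the summation of `f_q` up to `y` is controlled by the
discrepancies in progressions modulo `q` and in intervals of length `y`. -/
lemma maier_matrix (ha : ∀ n, 0 ≤ a n) (hx : 0 < x) (hA : 0 < count a x)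
    {h : ArithmeticFunction ℝ} (h1 : ∀ n, 0 ≤ h n ∧ h n ≤ 1) {q : ℕ} (hq : 0 < q) {y : ℝ}
    (hy : 0 < y) (hyq : y + 2 * q ≤ x / 4) {C : ℝ} (hC : (q : ℝ) ≤ C * Nat.totient q) :
    |∑ s ∈ Icc 1 ⌊y⌋₊, fFun h q s - gammaFactor h q * y| ≤
      y * (intervalDiscrepancy a x y + 4 * C * apDiscrepancy a h x q) := by
  have hq0 : (0 : ℝ) < q := by exact_mod_cast hq
  have hφ : (0 : ℝ) < Nat.totient q := by exact_mod_cast Nat.totient_pos.2 hq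
  have hγ := gammaFactor_pos h1 q
  have hγ1 := gammaFactor_le_one h1 q
  have hD0 := apDiscrepancy_nonneg hA h q
  have hI0 := intervalDiscrepancy_nonneg hx hA hy
  -- `Rq` is the first multiple of `q` from `x/4` on. `N` is then the largest number of rows that
  -- still end by `x`; they cover at least half of `[0, x]` in total step length `Nq`.
  obtain ⟨R, hR1, hR2⟩ : ∃ R : ℕ, x / 4 ≤ R * q ∧ R * q ≤ x / 4 + q := by
    refine ⟨⌈x / 4 / q⌉₊, ?_, ?_⟩
    · rw [← div_le_iff₀ hq0]; exact Nat.le_ceil _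
    · have := (Nat.ceil_lt_add_one (show 0 ≤ x / 4 / q by positivity)).le
      calc _ ≤ (x / 4 / q + 1) * q := by gcongr
        _ = _ := by field_simp
  obtain ⟨N, hN1, hN2⟩ : ∃ N : ℕ, ((R + N : ℕ) : ℝ) * q ≤ x - y ∧ x / 2 ≤ N * q := by
    have hnn : 0 ≤ (x - y - R * q) / q := div_nonneg (by linarith) hq0.le
    refine ⟨⌊(x - y - R * q) / q⌋₊, ?_, ?_⟩
    · have := Nat.floor_le hnn
      rw [le_div_iff₀ hq0] at this
      push_cast
      linarith
    · have := (Nat.lt_floor_add_one ((x - y - R * q) / q)).le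
      rw [div_le_iff₀ hq0] at this
      linarith
  have hN0 : (0 : ℝ) < N := by
    by_contra hneg
    push Not at hneg
    nlinarith
  set A := count a x with hAdef
  set D := ∑ r ∈ Icc 1 N, ∑ s ∈ Icc 1 ⌊y⌋₊, a ((R + r) * q + s) with hD
  have hrows : |D - N * (y * (A / x))| ≤
      N * (intervalDiscrepancy a x y * (y * (A / x))) := by
    have e1 : D - N * (y * (A / x)) = ∑ r ∈ Icc 1 N,
        (∑ s ∈ Icc 1 ⌊y⌋₊, a ((R + r) * q + s) - y * (A / x)) := by
      rw [sum_sub_distrib]; simp [hD]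
    rw [e1]
    refine (abs_sum_le_sum_abs _ _).trans ((sum_le_sum (g := fun _ =>
      intervalDiscrepancy a x y * (y * (A / x))) fun r hr => ?_).trans_eq (by simp))
    obtain ⟨hr1, hr2⟩ := mem_Icc.1 hr
    have hrN : (r : ℝ) ≤ N := by exact_mod_cast hr2
    rw [← count_add_sub a _ hy.le]
    push_cast at hN1 ⊢
    refine le_intervalDiscrepancy ha hx hA hy ?_ ?_
    · nlinarith [mul_nonneg (Nat.cast_nonneg (α := ℝ) r) hq0.le]
    · nlinarith
  -- Each column is the difference of two counts in the class of `s` modulo `q`, at points of `[x/4,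
  -- x]`; this accounts for the factor `2`.
  have hcols : |D - N * A / x / gammaFactor h q * ∑ s ∈ Icc 1 ⌊y⌋₊, fFun h q s| ≤
      y * (2 * (apDiscrepancy a h x q * (A / (Nat.totient q : ℝ)))) := by
    have e1 : D - N * A / x / gammaFactor h q * ∑ s ∈ Icc 1 ⌊y⌋₊, fFun h q s =
        ∑ s ∈ Icc 1 ⌊y⌋₊, (∑ r ∈ Icc 1 N, a ((R + r) * q + s) -
          N * A / x / gammaFactor h q * fFun h q s) := by
      rw [hD, sum_comm, sum_sub_distrib, mul_sum]
    rw [e1]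
    refine (abs_sum_le_sum_abs _ _).trans ((sum_le_sum (g := fun _ =>
      2 * (apDiscrepancy a h x q * (A / (Nat.totient q : ℝ)))) fun s hs => ?_).trans ?_)
    · obtain ⟨hs1, hs2⟩ := mem_Icc.1 hs
      have hsy : (s : ℝ) ≤ y := (Nat.cast_le.2 hs2).trans (Nat.floor_le hy.le)
      have hs0 : (0 : ℝ) ≤ s := Nat.cast_nonneg s
      have hNq : 0 ≤ (N : ℝ) * q := by positivity
      push_cast at hN1
      have t1 := le_apDiscrepancy ha hx hA h1 hq (t := ((R + N) * q + s : ℕ))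
        (by push_cast; nlinarith) (by push_cast; nlinarith) s
      have t0 := le_apDiscrepancy ha hx hA h1 hq (t := (R * q + s : ℕ))
        (by push_cast; nlinarith) (by push_cast; nlinarith) s
      rw [← countAP_sub a hq]
      rw [← hAdef] at t0 t1
      have e2 : countAP a ((R + N) * q + s : ℕ) q s - countAP a (R * q + s : ℕ) q s -
          N * A / x / gammaFactor h q * fFun h q s =
          (countAP a ((R + N) * q + s : ℕ) q s - fFun h q s / ((q : ℝ) * gammaFactor h q) *
            (((R + N) * q + s : ℕ) / x) * A) -
          (countAP a (R * q + s : ℕ) q s - fFun h q s / ((q : ℝ) * gammaFactor h q) *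
            ((R * q + s : ℕ) / x) * A) := by
        push_cast
        field_simp
        ring
      rw [e2]
      refine (abs_sub _ _).trans ?_
      linarith
    · rw [sum_const, nsmul_eq_mul]
      have : ((#(Icc 1 ⌊y⌋₊) : ℕ) : ℝ) ≤ y := by simpa using Nat.floor_le hy.le
      gcongr
  have hscale : N * A / x / gammaFactor h q *
      |∑ s ∈ Icc 1 ⌊y⌋₊, fFun h q s - gammaFactor h q * y| ≤
      N * (intervalDiscrepancy a x y * (y * (A / x))) +
      y * (2 * (apDiscrepancy a h x q * (A / (Nat.totient q : ℝ)))) := by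
    have hpos : 0 < N * A / x / gammaFactor h q := by positivity
    have e1 : N * A / x / gammaFactor h q *
        (∑ s ∈ Icc 1 ⌊y⌋₊, fFun h q s - gammaFactor h q * y) =
        (D - N * (y * (A / x))) -
        (D - N * A / x / gammaFactor h q * ∑ s ∈ Icc 1 ⌊y⌋₊, fFun h q s) := by
      field_simp
      ring
    rw [← abs_of_pos hpos, ← abs_mul, e1]
    exact (abs_sub _ _).trans (add_le_add hrows hcols)
  have hpos : 0 < N * A / x := by positivity
  -- `Nq ≥ x/2` and `q ≤ Cφ(q)` put the column error on the same scale as the row error.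
  have hk : A / (Nat.totient q : ℝ) ≤ N * A / x * (2 * C) := by
    rw [div_le_iff₀ hφ]
    have : x ≤ N * (2 * (C * Nat.totient q)) := by nlinarith
    calc A = A / x * x := by field_simp
      _ ≤ A / x * (N * (2 * (C * Nat.totient q))) := by gcongr
      _ = _ := by ring
  have hfin : N * A / x * |∑ s ∈ Icc 1 ⌊y⌋₊, fFun h q s - gammaFactor h q * y| ≤
      N * A / x * (y * (intervalDiscrepancy a x y + 4 * C * apDiscrepancy a h x q)) := by
    -- Since `γ_q ≤ 1`, dropping the division by `γ_q` only decreases the left side.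
    calc _ ≤ N * A / x / gammaFactor h q *
          |∑ s ∈ Icc 1 ⌊y⌋₊, fFun h q s - gammaFactor h q * y| := by
          refine mul_le_mul_of_nonneg_right ?_ (abs_nonneg _)
          rw [le_div_iff₀ hγ]
          nlinarith
      _ ≤ _ := hscale
      _ ≤ N * (intervalDiscrepancy a x y * (y * (A / x))) +
          y * (2 * (apDiscrepancy a h x q * (N * A / x * (2 * C)))) := by gcongr
      _ = _ := by ring
  exact le_of_mul_le_mul_left hfin hpos

end Discrepancy

/-! ### Size conditions and conclusion. -/

lemma le_exp_mul_totient {q : ℕ} {z η : ℝ} (hP : PrimesIn q z η)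
    (hz : 0 < Real.log z) (hη : η ≤ 1 / 100) : (q : ℝ) ≤ Real.exp 5 * Nat.totient q := by
  have h1 : (Nat.totient q : ℝ) = q * ∏ p ∈ q.primeFactors, (1 - (p : ℝ)⁻¹) := by
    have := congrArg (Rat.cast : ℚ → ℝ) (Nat.totient_eq_mul_prod_factors q)
    push_cast at this
    exact this
  have h2 : Real.exp (-5) ≤ ∏ p ∈ q.primeFactors, (1 - (p : ℝ)⁻¹) := by
    have e1 : -5 ≤ ∑ p ∈ q.primeFactors, -(2 * ((1 : ℝ) / p)) := by
      rw [sum_neg_distrib, ← mul_sum]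
      linarith [hP.sum_inv_le hz hη]
    refine (Real.exp_le_exp.2 e1).trans ?_
    rw [Real.exp_sum]
    refine prod_le_prod (fun _ _ => (Real.exp_pos _).le) fun p hp => ?_
    have h2 : (2 : ℝ) ≤ p := by exact_mod_cast (Nat.prime_of_mem_primeFactors hp).two_le
    have hx : (p : ℝ)⁻¹ ≤ 2⁻¹ := inv_anti₀ two_pos h2
    have hx0 : 0 < (p : ℝ)⁻¹ := by positivity
    have := exp_le_one_add (X := -(p : ℝ)⁻¹) (by linarith)
    rw [← sub_eq_add_neg] at this
    refine le_trans (Real.exp_le_exp.2 ?_) this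
    rw [one_div]
    nlinarith
  rw [h1]
  have h3 : Real.exp 5 * Real.exp (-5) = 1 := by rw [← Real.exp_add]; norm_num
  have hq : (0 : ℝ) ≤ q := Nat.cast_nonneg q
  nlinarith [mul_le_mul_of_nonneg_left h2 (mul_nonneg (Real.exp_pos 5).le hq)]

/-- With `X = x^(1/3)` one has `y ≤ X` and `q ≤ X²`, and `X + 2X² ≤ X³/4` once `X ≥ 13`. -/
lemma add_two_mul_le_of_le_exp {x z y q : ℝ} (hx : 9 ≤ Real.log x) (hx0 : 0 < x)
    (hz : z ≤ Real.log x / 3) (hy : y ≤ Real.exp z) (hq : q ≤ Real.exp (2 * z)) :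
    y + 2 * q ≤ x / 4 := by
  set X := Real.exp (Real.log x / 3) with hX
  have h1 : X ^ 3 = x := by
    rw [hX, ← Real.exp_nat_mul]
    push_cast
    rw [mul_div_cancel₀ _ (by norm_num), Real.exp_log hx0]
  have h2 : 13 ≤ X := by
    have e1 := Real.quadratic_le_exp_of_nonneg (show (0 : ℝ) ≤ 3 by norm_num)
    have e2 : Real.exp 1 ^ 3 = Real.exp 3 := by rw [← Real.exp_nat_mul]; norm_num
    have e3 : (2.7182818283 : ℝ) ^ 3 ≤ Real.exp 1 ^ 3 := by
      have := Real.exp_one_gt_d9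
      gcongr
    have e4 : Real.exp 3 ≤ X := Real.exp_le_exp.2 (by linarith)
    norm_num at e3
    linarith
  have h3 : Real.exp z ≤ X := Real.exp_le_exp.2 hz
  have h4 : Real.exp (2 * z) ≤ X ^ 2 := by
    rw [two_mul, Real.exp_add, sq]
    gcongr
  nlinarith [sq_nonneg X]

open Filter in
lemma exists_iterated_log_ge (B : ℝ) :
    ∃ x₀ : ℝ, ∀ x, x₀ ≤ x → 0 < x ∧ B ≤ Real.log x ∧ 0 < Real.log (Real.log x) ∧
      B ≤ Real.log (Real.log (Real.log x)) := by
  have t1 := Real.tendsto_log_atTop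
  have t2 := t1.comp t1
  have t3 := t1.comp t2
  obtain ⟨x₀, hx₀⟩ := eventually_atTop.1 ((eventually_gt_atTop 0).and ((t1.eventually_ge_atTop B).and
    ((t2.eventually_gt_atTop 0).and (t3.eventually_ge_atTop B))))
  exact ⟨x₀, fun x hx => hx₀ x hx⟩

/-- Consequences of the size constraints on `η`, `z`, `u` in terms of iterated logarithms. -/
lemma size_constraints {x η z u : ℝ} (hx1 : 9 ≤ Real.log x) (hl2 : 0 < Real.log (Real.log x))
    (hl3 : 9 ≤ Real.log (Real.log (Real.log x)))
    (hη : 20 * Real.log (Real.log (Real.log x)) / Real.log (Real.log x) ≤ η)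
    (hz : (Real.log x) ^ η ≤ z) (hu0 : 0 < u) (hu : u ≤ √z) :
    0 < η ∧ 0 < z ∧ 20 * Real.log (Real.log (Real.log x)) ≤ Real.log z ∧
      Real.log (1 / η) ≤ Real.log z / 20 ∧ Real.log u ≤ Real.log z / 2 ∧
      z ^ (5 / 4 * u) ≤ Real.exp z := by
  have hl1 : 0 < Real.log x := by linarith
  have hη0 : 0 < η := lt_of_lt_of_le (by positivity) hη
  have hz0 : 0 < z := lt_of_lt_of_le (by positivity) hz
  have hlz : 20 * Real.log (Real.log (Real.log x)) ≤ Real.log z := by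
    have e1 := Real.log_le_log (by positivity) hz
    rw [Real.log_rpow hl1] at e1
    rw [div_le_iff₀ hl2] at hη
    linarith
  refine ⟨hη0, hz0, hlz, ?_, ?_, ?_⟩
  · have e1 : 1 / η ≤ Real.log (Real.log x) := by
      rw [div_le_iff₀ hl2] at hη
      rw [div_le_iff₀ hη0]
      linarith
    have := Real.log_le_log (by positivity) e1
    linarith
  · rw [← Real.log_sqrt hz0.le]
    exact Real.log_le_log hu0 hu
  · rw [Real.rpow_def_of_pos hz0]
    apply Real.exp_le_exp.2
    have hl : 100 ≤ Real.log z := by linarith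
    have e1 : 5 / 4 * Real.log z ≤ √z := by
      have e2 := Real.quadratic_le_exp_of_nonneg (show 0 ≤ Real.log z / 2 by linarith)
      rw [← Real.log_sqrt hz0.le, Real.exp_log (by positivity), Real.log_sqrt hz0.le] at e2
      nlinarith
    calc Real.log z * (5 / 4 * u) = 5 / 4 * Real.log z * u := by ring
      _ ≤ √z * √z := by gcongr
      _ = z := Real.mul_self_sqrt hz0.le

end SeqDistribution

end

theorem theorem2p5 :
    ∃ c : ℝ, 0 < c ∧ ∃ x₀ : ℝ, ∀ x : ℝ, x₀ ≤ x →
      ∀ a : ℕ → ℝ, (∀ n, 0 ≤ a n) → 0 < SeqDistribution.count a x →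
      ∀ S : Finset ℕ, (∀ p ∈ S, p.Prime) → (∀ p ∈ S, (p : ℝ) ≤ Real.log (Real.log x)) →
      ∀ h : ArithmeticFunction ℝ, h.IsMultiplicative → (∀ n, 0 ≤ h n ∧ h n ≤ 1) →
      ∀ η : ℝ, 20 * Real.log (Real.log (Real.log x)) / Real.log (Real.log x) ≤ η → η ≤ 1 / 100 →
      ∀ z : ℝ, (Real.log x) ^ η ≤ z → z ≤ Real.log x / 3 →
      η * Real.log ((1 - η)⁻¹) ≤
        ∑ p ∈ (Finset.Icc ⌈z ^ (1 - η)⌉₊ ⌊z⌋₊).filter Nat.Prime, (1 - h p) / (p : ℝ) →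
      ∀ u : ℝ, 5 / η ^ 2 ≤ u → u ≤ Real.sqrt z →
        (∀ q : ℕ, 0 < q → (q : ℝ) ≤ Real.exp (2 * z) →
          (∀ p : ℕ, p.Prime → p ∣ q → z ^ (1 - η) ≤ (p : ℝ) ∧ (p : ℝ) ≤ z) →
          η ^ 2 ≤ ∑ p ∈ q.primeFactors, (1 - h p) / (p : ℝ) →
          (∀ p ∈ S, Nat.Coprime q p) ∧
          c * Real.exp (-(u * (1 + 25 * η) * Real.log (2 * u / η ^ 2))) ≤
            SeqDistribution.apDiscrepancy a h x q) ∨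
        (∃ y : ℝ, z ^ u ≤ y ∧
          c * Real.exp (-(u * (1 + 25 * η) * Real.log (2 * u / η ^ 2))) ≤
            SeqDistribution.intervalDiscrepancy a x y) := by
  open SeqDistribution in
  -- Chosen so that `c(1 + 4e^5) = 1/16`, the constant of `exists_large_error`; here `e^5` bounds
  -- `q/φ(q)`.
  refine ⟨1 / (16 * (1 + 4 * Real.exp 5)), by positivity, ?_⟩
  obtain ⟨x₀, hx₀⟩ := exists_iterated_log_ge 9
  refine ⟨x₀, fun x hx a ha hA S hS hSx h hm h1 η hη hη1 z hz hzx _ u hu huz => ?_⟩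
  obtain ⟨hx0, hx1, hx2, hx3⟩ := hx₀ x hx
  have hu0 : 0 < u := by
    have : 0 < η := lt_of_lt_of_le (by positivity) hη
    exact lt_of_lt_of_le (by positivity) hu
  obtain ⟨hη0, hz0, hlz, hηz, huz', hzu⟩ := size_constraints hx1 hx2 hx3 hη hz hu0 huz
  have hl0 : 0 < Real.log z := by linarith
  refine or_iff_not_imp_right.2 fun hII q hq hqz hqP hqG => ⟨fun p hp => ?_, ?_⟩
  -- A common prime would satisfy `z^(1-η) ≤ p ≤ log log x`, whereas `log z ≥ 20 log log log x`.
  · refine (((hS p hp).coprime_iff_not_dvd).2 fun hpq => ?_).symm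
    have e1 := (hqP p (hS p hp) hpq).1.trans (hSx p hp)
    have e2 := Real.log_le_log (by positivity) e1
    rw [Real.log_rpow hz0] at e2
    nlinarith
  · by_contra hΔ
    push Not at hΔ
    have hP : PrimesIn q z η := fun p hp =>
      hqP p (Nat.prime_of_mem_primeFactors hp) (Nat.dvd_of_mem_primeFactors hp)
    obtain ⟨y, hy1, hy2, hy⟩ := exists_large_error hm h1 hq.ne' hz0 (by linarith) hη0 hη1 hηz hP
      hqG hu huz'
    have hy0 : 0 < y := lt_of_lt_of_le (by positivity) hy1
    have hmat := maier_matrix ha hx0 hA h1 hq hy0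
      (add_two_mul_le_of_le_exp hx1 hx0 hzx (hy2.trans hzu) hqz) (le_exp_mul_totient hP hl0 hη1)
    have hI : intervalDiscrepancy a x y < _ := not_le.1 fun hle => hII ⟨y, hy1, hle⟩
    set E := Real.exp (-(u * (1 + 25 * η) * Real.log (2 * u / η ^ 2)))
    have hsum : intervalDiscrepancy a x y + 4 * Real.exp 5 * apDiscrepancy a h x q ≤
        1 / 16 * E := by
      calc _ ≤ 1 / (16 * (1 + 4 * Real.exp 5)) * E +
            4 * Real.exp 5 * (1 / (16 * (1 + 4 * Real.exp 5)) * E) := by gcongr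
        _ = _ := by field_simp
    have := hy.trans_le (hmat.trans (mul_le_mul_of_nonneg_left hsum hy0.le))
    linarith
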